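/- Let $D=(V,A)$ be a finite directed graph (parallel arcs allowed) with a balance function $b\colon V\to\mathbb R$; vertices with $b(v)>0$ are sources, vertices with $b(v)<0$ are sinks. A $b$-transshipment is a vector $x\in\mathbb R^A_{\ge 0}$ with $\sum_{a\in\delta^{\rm out}(v)}x_a-\sum_{a\in\delta^{\rm in}(v)}x_a=b(v)$ for all $v\in V$. An unsplittable $b$-transshipment is a $b$-transshipment together with a path decomposition into source–sink paths only, with at most one path for each source–sink pair. Let $c\in\mathbb R^A_{\ge 0}$ be arc capacities satisfying the balance condition: $c_a\ge |b(t)|$ for every arc $a$ and every sink $t$. The congestion of a transshipment $y$ is $\max_{a}y_a/c_a$. Minimizing congestion means, as usual, finding an unsplittable $b$-transshipment $y$ for which the smallest factor $\alpha\ge 1$ with $y\le\alpha c$ is as small as possible, i.e. minimizing $\alpha(y):=\max\{1,\max_a y_a/c_a\}$. The Modified DGG Algorithm takes as input $(D,b)$ and a $b$-transshipment $x$ with no directed cycle of flow-carrying arcs (automatic if $D$ is acyclic). Add a super-source $s^*$ with a dummy arc $(s^*,s)$ of flow $b(s)$ to every source $s$; put at each sink $t$ a token of demand $d_t=|b(t)|$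 and set $y:=x$. Arcs of zero flow are deleted. Moving a token of demand $d$ from $v$ backward along $(u,v)$ places it at $u$ and decreases the flow on $(u,v)$ by $d$. 1. *Preliminary phase:* as long as possible, move tokens backward along arcs whose flow is at least their demand. 2. *Iterations*, until all tokens have reached $s^*$: call a vertex funnel if it has at most one outgoing arc, and label an arc singular if its head and all vertices reachable from it are funnel vertices. Build a walk from an arbitrary vertex with an outgoing arc: go forward along arcs until a vertex $w$ without outgoing arcs is reached, by an arc $a'$; then go backward from $w$, not using $a'$, along singular arcs leading back to a non-funnel vertex other than $s^*$; from that vertex go forward again along an arc different from the one just used; and so on. (a) When a vertex is revisited, an alternating cycle $C$ is closed. Decrease $y$ on its forward arcs and increase $y$ on its backward arcs by the minimum of the flows on forward arcs and of the values $d_t-y_a$ over backward arcs $a$ and tokens $t$ at the head of $a$ with $d_t>y_a$. (b) If instead, at some $w$ reached by $a'$, no non-funnel vertex other than $s^*$ is reachable along backward paths that ignore $a'$, take a token $t$ at $w$ with $d_t>y_{a'}$ and split it into parts of demand $y_{a'}$ and $d_t-y_{a'}$. Decompose the flow on the arcs explored backward from $w$ (without $a'$) into paths from $s^*$ to the second part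 and to all other tokens at the explored vertices, greedily path by path; split these tokens accordingly and move them along their paths to $s^*$; delete these arcs; then move the first part of $t$ along $a'$. After (a) or (b), as long as possible, move tokens backward along arcs labeled singular at the beginning of the iteration whose flow equals their demand, or along other arcs whose flow is at least their demand. The output consists of the paths traced by the (parts of) tokens from sinks back to sources, with the demands moved along them. **Claim.** The Modified DGG Algorithm yields a 2-approximation algorithm for minimizing congestion. Precisely: whenever a $b$-transshipment exists, there is a $b$-transshipment $x$ without directed cycles of flow-carrying arcs that minimizes $\alpha$ among all (fractional) $b$-transshipments; and, for every such $x$ and however the choices left open are made, the Modified DGG Algorithm started with $x$ never gets stuck, terminates after a number of elementary operations (arithmetic operations and comparisons of numbers, inspections of vertices, arcs and tokens) that is bounded by a polynomial in $|V|+|A|$ independent of the instance, and returns an unsplittable $b$-transshipment $y$ with $\alpha(y)\le 2\,\alpha(z)$ for every unsplittable $b$-transshipment $z$. -/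

import Mathlib

universe u v

namespace UnsplitTrans

/-! ### Transshipments, unsplittable transshipments, congestion -/

/-- A directed (multi)graph with vertex set `V` and arc set `A`. -/
structure Net (V : Type u) (A : Type v) where
  tail : A → V
  head : A → V

section Problem

variable {V : Type u} {A : Type v}

open Classical in
/-- `x` is a (fractional) `b`-transshipment. -/
def IsTransshipment [Fintype A] (D : Net V A) (b : V → ℝ) (x : A → ℝ) : Prop :=
  (∀ a, 0 ≤ x a) ∧
    ∀ v, (∑ a with D.tail a = v, x a) - (∑ a with D.head a = v, x a) = b v

/-- The arcs `l` form, in this order, a directed walk from `u` to `w`. -/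
def IsWalk (D : Net V A) : V → List A → V → Prop
  | u, [], w => u = w
  | u, a :: l, w => D.tail a = u ∧ IsWalk D (D.head a) l w

/-- A directed path: a directed walk that visits no vertex twice. -/
def IsPath (D : Net V A) (u : V) (l : List A) (w : V) : Prop :=
  IsWalk D u l w ∧ (u :: l.map D.head).Nodup

/-- A path from a source to a sink together with the amount of flow sent along it. -/
structure PathFlow (V : Type u) (A : Type v) where
  source : V
  sink : V
  arcs : List A
  amount : ℝ

open Classical in
/-- The arc flow that a collection of path flows induces. -/
noncomputable def totalFlow (P : List (PathFlow V A)) (a : A) : ℝ :=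
  (P.map fun p => if a ∈ p.arcs then p.amount else 0).sum

/-- `P` is an unsplittable `b`-transshipment: a `b`-transshipment given by a path decomposition
that consists of source-sink paths only, at most one for each source-sink pair. -/
structure IsUnsplittable [Fintype A] (D : Net V A) (b : V → ℝ) (P : List (PathFlow V A)) :
    Prop where
  source_pos : ∀ p ∈ P, 0 < b p.source
  sink_neg : ∀ p ∈ P, b p.sink < 0
  amount_pos : ∀ p ∈ P, 0 < p.amount
  isPath : ∀ p ∈ P, IsPath D p.source p.arcs p.sink
  pairs : (P.map fun p => (p.source, p.sink)).Nodup
  isTransshipment : IsTransshipment D b (totalFlow P)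

/-- Congestion: the maximum over all arcs of the ratio of flow to capacity. -/
noncomputable def congestion (c y : A → ℝ) : ℝ := ⨆ a, y a / c a

/-- The objective value: the smallest factor `α ≥ 1` by which the capacities have to be multiplied
for `y` to respect them. -/
noncomputable def congestionFactor (c y : A → ℝ) : ℝ := max 1 (congestion c y)

/-- Every arc capacity is at least the maximum demand. -/
def BalanceCondition (b : V → ℝ) (c : A → ℝ) : Prop :=
  ∀ t, b t < 0 → ∀ a, |b t| ≤ c a

/-- No directed cycle consists of arcs that carry positive flow. -/
def AcyclicSupport (D : Net V A) (x : A → ℝ) : Prop :=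
  ∀ v, ¬ Relation.TransGen (fun u w => ∃ a, 0 < x a ∧ D.tail a = u ∧ D.head a = w) v v

/-- `x` is an optimal fractional solution without flow-carrying directed cycles. -/
structure IsOptimalFractional [Fintype A] (D : Net V A) (b : V → ℝ) (c x : A → ℝ) : Prop where
  isTransshipment : IsTransshipment D b x
  acyclic : AcyclicSupport D x
  minimal : ∀ x', IsTransshipment D b x' → congestionFactor c x ≤ congestionFactor c x'

end Problem

/-! ### The Modified DGG Algorithm -/

section Algorithm

variable {V : Type u} {A : Type v}

/-- Arcs of the network with super-source: the original arcs and one dummy arc from the super-source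
to every source. -/
abbrev SArc (A : Type v) (b : V → ℝ) := A ⊕ {s : V // 0 < b s}

/-- Tail of an arc of the extended network; `none` is the super-source. -/
def stail (D : Net V A) (b : V → ℝ) : SArc A b → Option V
  | .inl a => some (D.tail a)
  | .inr _ => none

/-- Head of an arc of the extended network. -/
def shead (D : Net V A) (b : V → ℝ) : SArc A b → V
  | .inl a => D.head a
  | .inr s => s.1

/-- The arcs that leave `u`. Throughout, an arc is present in the current network if and only if it
carries positive flow. -/
def outArcs (D : Net V A) (b : V → ℝ) (y : SArc A b → ℝ) (u : Option V) : Set (SArc A b) :=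
  {e | 0 < y e ∧ stail D b e = u}

/-- Reachability in the current network. -/
def Reach (D : Net V A) (b : V → ℝ) (y : SArc A b → ℝ) : V → V → Prop :=
  Relation.ReflTransGen fun u w => ∃ e, 0 < y e ∧ stail D b e = some u ∧ shead D b e = w

/-- Funnel vertices have at most one outgoing arc. -/
def Funnel (D : Net V A) (b : V → ℝ) (y : SArc A b → ℝ) (w : V) : Prop :=
  (outArcs D b y (some w)).Subsingleton

/-- An arc is singular if its head and all vertices reachable from it have out-degree at most 1. -/
def singular (D : Net V A) (b : V → ℝ) (y : SArc A b → ℝ) : Set (SArc A b) :=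
  {e | ∀ w, Reach D b y (shead D b e) w → Funnel D b y w}

/-- A non-funnel vertex other than the super-source can be reached from `u` along a backward path of
singular arcs whose vertices before the last one are funnel vertices. -/
inductive LeadsToNonFunnel (D : Net V A) (b : V → ℝ) (y : SArc A b → ℝ) : V → Prop
  | here {u : V} (h : ¬ Funnel D b y u) : LeadsToNonFunnel D b y u
  | back {u u' : V} {e : SArc A b} (hu : Funnel D b y u) (hpos : 0 < y e)
      (hs : e ∈ singular D b y) (hhead : shead D b e = u) (htail : stail D b e = some u')
      (h : LeadsToNonFunnel D b y u') : LeadsToNonFunnel D b y u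

/-- Vertices other than the super-source explored by the backward search that starts at the junction
vertex `w` and ignores the arc `a'`. -/
inductive BackReach (D : Net V A) (b : V → ℝ) (y : SArc A b → ℝ) (w : V) (a' : SArc A b) : V → Prop
  | root : BackReach D b y w a' w
  | back {u u' : V} {e : SArc A b} (h : BackReach D b y w a' u) (hpos : 0 < y e) (hne : e ≠ a')
      (hs : e ∈ singular D b y) (hhead : shead D b e = u) (htail : stail D b e = some u') :
      BackReach D b y w a' u'

/-- Direction in which an arc is traversed by an alternating walk. -/
inductive Dir
  | fwd
  | bwd

/-- The vertex that a traversed arc leads to. -/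
def endpt (D : Net V A) (b : V → ℝ) : SArc A b × Dir → Option V
  | (e, .fwd) => some (shead D b e)
  | (e, .bwd) => stail D b e

/-- Current vertex of the walk that starts at `u` and traverses the arcs of the list, the most
recently traversed arc being the first entry. -/
def curr (D : Net V A) (b : V → ℝ) (u : Option V) : List (SArc A b × Dir) → Option V
  | [] => u
  | p :: _ => endpt D b p

/-- All vertices visited by a walk (most recent arc first). -/
def visited (D : Net V A) (b : V → ℝ) (u : Option V) : List (SArc A b × Dir) → List (Option V)
  | [] => [u]
  | p :: W => endpt D b p :: visited D b u W

/-- The admissible continuations of an alternating walk by one arc.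
A forward path is continued until it reaches a junction vertex (no outgoing arcs); there a backward
path starts with another incoming arc and runs along singular arcs that lead back to a non-funnel
vertex other than the super-source; at that vertex a new forward path starts with another outgoing
arc. -/
inductive Extends (D : Net V A) (b : V → ℝ) (y : SArc A b → ℝ) (u : Option V) :
    List (SArc A b × Dir) → SArc A b × Dir → Prop
  | start {e : SArc A b} (he : e ∈ outArcs D b y u) : Extends D b y u [] (e, .fwd)
  | fwd_fwd {W : List (SArc A b × Dir)} {f e : SArc A b}
      (he : e ∈ outArcs D b y (some (shead D b f))) :
      Extends D b y u ((f, .fwd) :: W) (e, .fwd)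
  | fwd_bwd {W : List (SArc A b × Dir)} {f e : SArc A b} {u' : V}
      (hjunction : outArcs D b y (some (shead D b f)) = ∅)
      (hpos : 0 < y e) (hne : e ≠ f) (hs : e ∈ singular D b y)
      (hhead : shead D b e = shead D b f) (htail : stail D b e = some u')
      (h : LeadsToNonFunnel D b y u') :
      Extends D b y u ((f, .fwd) :: W) (e, .bwd)
  | bwd_bwd {W : List (SArc A b × Dir)} {f e : SArc A b} {w u' : V}
      (hw : stail D b f = some w) (hfunnel : Funnel D b y w)
      (hpos : 0 < y e) (hs : e ∈ singular D b y)
      (hhead : shead D b e = w) (htail : stail D b e = some u')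
      (h : LeadsToNonFunnel D b y u') :
      Extends D b y u ((f, .bwd) :: W) (e, .bwd)
  | bwd_fwd {W : List (SArc A b × Dir)} {f e : SArc A b} {w : V}
      (hw : stail D b f = some w) (hnonfunnel : ¬ Funnel D b y w)
      (he : e ∈ outArcs D b y (some w)) (hne : e ≠ f) :
      Extends D b y u ((f, .bwd) :: W) (e, .fwd)

/-- Data of the algorithm. At any time every sink `t` has at most one (sub-)sink that has not yet
reached the super-source: it has demand `dem t` (with `dem t = 0` if there is none), is located at
`pos t`, and has been moved backward along the path `trail t` from `pos t` to `t`. -/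
structure State (V : Type u) (A : Type v) (b : V → ℝ) where
  /-- current flow -/
  y : SArc A b → ℝ
  dem : V → ℝ
  pos : V → V
  trail : V → List A
  /-- paths traced by the (sub-)sinks that have reached the super-source -/
  routed : List (PathFlow V A)

/-- Control state of the algorithm. -/
inductive Phase (V : Type u) (A : Type v) (b : V → ℝ)
  /-- Moving (sub-)sinks backward; `S` is the set of arcs that are labeled singular. -/
  | move (S : Set (SArc A b))
  /-- Constructing an alternating cycle: `W` is the walk found so far from the vertex `u`. -/
  | search (u : Option V) (W : List (SArc A b × Dir))
  /-- Routing the (sub-)sinks in a singular digraph with arc set `T` and vertex set `R` (and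
  possibly the super-source); the (sub-)sink of `t` is the one that is split, and the part of it
  whose demand is the flow on `a'` is going to be moved along `a'`. -/
  | route (S T : Set (SArc A b)) (R : Set V) (t : V) (a' : SArc A b)

structure Config (V : Type u) (A : Type v) (b : V → ℝ) where
  phase : Phase V A b
  state : State V A b

open Classical in
/-- Move the (sub-)sink of `t` backward along the arc `e`, decreasing the flow on `e` accordingly. -/
noncomputable def moveAlong (D : Net V A) (b : V → ℝ) (σ : State V A b) (t : V) :
    SArc A b → State V A b
  | .inl a =>
    { σ with
      y := Function.update σ.y (.inl a) (σ.y (.inl a) - σ.dem t)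
      pos := Function.update σ.pos t (D.tail a)
      trail := Function.update σ.trail t (a :: σ.trail t) }
  | .inr s =>
    { σ with
      y := Function.update σ.y (.inr s) (σ.y (.inr s) - σ.dem t)
      dem := Function.update σ.dem t 0
      routed := ⟨s.1, t, σ.trail t, σ.dem t⟩ :: σ.routed }

/-- Moving rule: along singular arcs that carry exactly the demand, and along non-singular arcs that
carry at least the demand. -/
def CanMove (D : Net V A) (b : V → ℝ) (S : Set (SArc A b)) (σ : State V A b) (t : V)
    (e : SArc A b) : Prop :=
  0 < σ.dem t ∧ shead D b e = σ.pos t ∧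
    ((e ∈ S ∧ σ.y e = σ.dem t) ∨ (e ∉ S ∧ σ.dem t ≤ σ.y e))

/-- The values whose minimum is the amount of augmentation along the alternating cycle `C`. -/
def augmentValues (D : Net V A) (b : V → ℝ) (σ : State V A b) (C : List (SArc A b × Dir)) :
    Set ℝ :=
  {r | (∃ e, (e, Dir.fwd) ∈ C ∧ r = σ.y e) ∨
    ∃ e t, (e, Dir.bwd) ∈ C ∧ 0 < σ.dem t ∧ σ.pos t = shead D b e ∧ σ.y e < σ.dem t ∧
      r = σ.dem t - σ.y e}

open Classical in
/-- Decrease the flow by `ε` on forward arcs of `C` and increase it by `ε` on backward arcs. -/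
noncomputable def augment {b : V → ℝ} (σ : State V A b) (C : List (SArc A b × Dir)) (ε : ℝ) :
    State V A b :=
  { σ with
    y := fun e =>
      if (e, Dir.fwd) ∈ C then σ.y e - ε else if (e, Dir.bwd) ∈ C then σ.y e + ε else σ.y e }

open Classical in
/-- The part of the demand of the (sub-)sink of `t'` that is still to be routed inside the singular
digraph. -/
noncomputable def residual {b : V → ℝ} (σ : State V A b) (t : V) (a' : SArc A b) (t' : V) : ℝ :=
  if t' = t then σ.dem t' - σ.y a' else σ.dem t'

/-- The arcs of the path that starts at the super-source, uses the dummy arc to `s` and continues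
along `l`. -/
def starPath {b : V → ℝ} (s : {s : V // 0 < b s}) (l : List A) : Set (SArc A b) :=
  {e | e = .inr s ∨ ∃ a ∈ l, e = .inl a}

open Classical in
/-- Split off a sub-sink of demand `ε` from the (sub-)sink of `t'` and move it backward along `l` to
the source `s` and on to the super-source. -/
noncomputable def sendBack {b : V → ℝ} (σ : State V A b) (t' : V) (s : {s : V // 0 < b s})
    (l : List A) (ε : ℝ) : State V A b :=
  { σ with
    y := fun e => if e ∈ starPath s l then σ.y e - ε else σ.y e
    dem := Function.update σ.dem t' (σ.dem t' - ε)
    routed := ⟨s.1, t', l ++ σ.trail t', ε⟩ :: σ.routed }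

open Classical in
/-- Remove the arcs of `T` from the network. -/
noncomputable def removeArcs {b : V → ℝ} (σ : State V A b) (T : Set (SArc A b)) : State V A b :=
  { σ with y := fun e => if e ∈ T then 0 else σ.y e }

/-- One action of the Modified DGG Algorithm. All choices that the algorithm leaves open are
nondeterministic. -/
inductive Step (D : Net V A) (b : V → ℝ) : Config V A b → Config V A b → Prop
  /-- A (sub-)sink is moved backward along one arc. -/
  | move {S : Set (SArc A b)} {σ : State V A b} {t : V} {e : SArc A b}
      (h : CanMove D b S σ t e) :
      Step D b ⟨.move S, σ⟩ ⟨.move S, moveAlong D b σ t e⟩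
  /-- If no (sub-)sink can be moved any more and some have not reached the super-source, a new
  iteration begins: arcs are labeled and a start vertex for the alternating walk is chosen. -/
  | iterate {S : Set (SArc A b)} {σ : State V A b} {u : Option V}
      (hactive : ∃ t, 0 < σ.dem t) (hstuck : ∀ t e, ¬ CanMove D b S σ t e)
      (hu : (outArcs D b σ.y u).Nonempty) :
      Step D b ⟨.move S, σ⟩ ⟨.search u [], σ⟩
  /-- The alternating walk is continued to a vertex not visited before. -/
  | extend {u : Option V} {W : List (SArc A b × Dir)} {σ : State V A b} {p : SArc A b × Dir}
      (hp : Extends D b σ.y u W p) (hnew : endpt D b p ∉ visited D b u W) :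
      Step D b ⟨.search u W, σ⟩ ⟨.search u (p :: W), σ⟩
  /-- The alternating walk revisits a vertex, which closes a nice alternating cycle `C`; the flow is
  augmented along `C`. -/
  | close {u : Option V} {W : List (SArc A b × Dir)} {σ : State V A b} {p : SArc A b × Dir}
      {C W' : List (SArc A b × Dir)} {ε : ℝ}
      (hp : Extends D b σ.y u W p) (hC : p :: W = C ++ W') (hne : C ≠ [])
      (hrevisit : curr D b u W' = endpt D b p) (hε : IsLeast (augmentValues D b σ C) ε) :
      Step D b ⟨.search u W, σ⟩ ⟨.move (singular D b σ.y), augment σ C ε⟩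
  /-- All backward paths from the junction vertex (other than those along the arc `a'` by which it
  was reached) lead to the super-source, which yields a singular digraph; a (sub-)sink located at
  the junction vertex with demand larger than the flow on `a'` is chosen. -/
  | singularDigraph {u : Option V} {W : List (SArc A b × Dir)} {σ : State V A b} {a' : SArc A b}
      {t : V}
      (hjunction : outArcs D b σ.y (some (shead D b a')) = ∅)
      (hnone : ∀ e u', 0 < σ.y e → e ≠ a' → shead D b e = shead D b a' → stail D b e = some u' →
        ¬ LeadsToNonFunnel D b σ.y u')
      (hpos : σ.pos t = shead D b a') (hdem : σ.y a' < σ.dem t) :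
      Step D b ⟨.search u ((a', .fwd) :: W), σ⟩
        ⟨.route (singular D b σ.y)
          {e | 0 < σ.y e ∧ e ≠ a' ∧ BackReach D b σ.y (shead D b a') a' (shead D b e)}
          {w | BackReach D b σ.y (shead D b a') a' w} t a', σ⟩
  /-- A path of the decomposition of the flow on the singular digraph is removed, together with a
  sub-sink that is moved backward along it to the super-source. -/
  | sendBack {S T : Set (SArc A b)} {R : Set V} {t : V} {a' : SArc A b} {σ : State V A b}
      {t' : V} {s : {s : V // 0 < b s}} {l : List A} {ε : ℝ}
      (hres : 0 < residual σ t a' t') (hl : IsPath D s.1 l (σ.pos t'))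
      (hT : ∀ e ∈ starPath s l, e ∈ T ∧ 0 < σ.y e)
      (hε : IsLeast ({residual σ t a' t'} ∪ σ.y '' starPath s l) ε) :
      Step D b ⟨.route S T R t a', σ⟩ ⟨.route S T R t a', sendBack σ t' s l ε⟩
  /-- The singular digraph is removed once all its demand has been routed, and the remaining part of
  the split (sub-)sink is moved backward along `a'`. -/
  | finishRoute {S T : Set (SArc A b)} {R : Set V} {t : V} {a' : SArc A b} {σ : State V A b}
      (hdone : ∀ t', σ.pos t' ∈ R → residual σ t a' t' = 0) :
      Step D b ⟨.route S T R t a', σ⟩ ⟨.move S, moveAlong D b (removeArcs σ T) t a'⟩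

/-- Start of the algorithm on the fractional transshipment `x`. In the preliminary phase no arc is
labeled singular. -/
noncomputable def initial (b : V → ℝ) (x : A → ℝ) : Config V A b where
  phase := .move ∅
  state :=
    { y := Sum.elim x fun s => b s.1
      dem := fun t => max (-b t) 0
      pos := id
      trail := fun _ => []
      routed := [] }

/-- All (sub-)sinks have reached the super-source. -/
def Finished {b : V → ℝ} (κ : Config V A b) : Prop := ∀ t, κ.state.dem t = 0

/-- Number of elementary operations (arithmetic operations and comparisons of numbers, inspections of
a vertex, an arc or a (sub-)sink) charged for one action; it pays for labeling the arcs, for a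
graph search, and for a scan of all pairs of an arc and a (sub-)sink. -/
def actionCost (V : Type u) (A : Type v) [Fintype V] [Fintype A] : ℕ :=
  (Fintype.card V + Fintype.card A + 1) ^ 2

/-- `Run D b κ T κ'`: some execution leads from `κ` to `κ'` with running time `T`. -/
inductive Run [Fintype V] [Fintype A] (D : Net V A) (b : V → ℝ) (κ : Config V A b) :
    ℕ → Config V A b → Prop
  | refl : Run D b κ 0 κ
  | tail {T : ℕ} {κ₁ κ₂ : Config V A b} (h : Run D b κ T κ₁) (hs : Step D b κ₁ κ₂) :
      Run D b κ (T + actionCost V A) κ₂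

end Algorithm

end UnsplitTrans

namespace UnsplitTrans

open Classical

/-! ### Walks and acyclic supports -/

section Walks

variable {V : Type u} {A : Type v} {D : Net V A}

/-! The factor 2 comes from an additive bound: on every arc the output exceeds `x` by at most the
largest demand, hence by at most the capacity (`ConfigInv.totalFlow_le`). As the factor of `x` is at
least 1, this extra unit of congestion at most doubles it, and every unsplittable solution is also a
fractional one.

The additive bound is the invariant `LoadOK`. While an arc has not been a backward arc of an
augmentation, the load routed on it plus its remaining flow stays at most `x`. Only singular arcs
get more flow, and from then on their load remains at most `x` until a token crosses; an ordinary
crossing requires flow equal to demand, so it adds one demand and deletes the arc. A singular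
digraph is routed all at once, so there the remaining flow itself must be at most one demand. This
is `SearchInv.exists_le_dem`: the flow of a singular arc can be followed along unique outgoing arcs
to a token with at least that demand.

The algorithm cannot get stuck because flow conservation supplies whatever is needed: `Regular`
controls which tokens can be smaller than an incoming flow, and it yields the large token at a
junction (`SearchInv.exists_token`) and the paths of a singular digraph (`RouteInv.exists_path`).
Pairs are not repeated because, outside the routing, a served pair has lost its token's demand or
its dummy arc (`PairsOK`). Inside a singular digraph out-degrees are at most one, so the path from a
given source to a given vertex is unique, and each path removal either satisfies the token or blocks
that path; when routing ends, the whole digraph is empty (`RouteInv.y_eq_zero`).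

Acyclicity of the support of `x` provides a bounded rank that increases along arcs. It drives the
inductions along flow and makes every token move count, so a potential bounds the number of actions
(`ConfigInv.step`). -/

theorem IsWalk.append {u v w : V} {l₁ l₂ : List A} (h₁ : IsWalk D u l₁ v) (h₂ : IsWalk D v l₂ w) :
    IsWalk D u (l₁ ++ l₂) w := by
  induction l₁ generalizing u with
  | nil => cases h₁; exact h₂
  | cons a l ih => exact ⟨h₁.1, ih h₁.2⟩

theorem IsWalk.sum_sub {u w : V} {l : List A} (h : IsWalk D u l w) (f : V → ℝ) :
    (l.map fun a => f (D.head a) - f (D.tail a)).sum = f w - f u := by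
  induction l generalizing u with
  | nil => cases h; simp
  | cons a l ih =>
    obtain ⟨rfl, h⟩ := h
    simp [ih h]

/-- Arcs with positive value lead from lower to higher rank. -/
def Ranked (D : Net V A) (x : A → ℝ) (r : V → ℕ) : Prop :=
  ∀ a, 0 < x a → r (D.tail a) < r (D.head a)

/-- The rank strictly increases along the walk, so no vertex can recur. -/
theorem IsWalk.isPath {x : A → ℝ} {r : V → ℕ} (hr : Ranked D x r) {u w : V} {l : List A}
    (h : IsWalk D u l w) (hx : ∀ a ∈ l, 0 < x a) : IsPath D u l w := by
  refine ⟨h, ?_⟩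
  suffices H : (u :: l.map D.head).Nodup ∧ ∀ v ∈ l.map D.head, r u < r v from H.1
  induction l generalizing u with
  | nil => simp
  | cons a l ih =>
    obtain ⟨rfl, h⟩ := h
    obtain ⟨h1, h2⟩ := ih h fun b hb => hx b (List.mem_cons_of_mem _ hb)
    have ha := hr a (hx a List.mem_cons_self)
    have h3 : ∀ v ∈ (a :: l).map D.head, r (D.tail a) < r v := by
      intro v hv
      rw [List.map_cons, List.mem_cons] at hv
      rcases hv with rfl | hv
      · exact ha
      · exact ha.trans (h2 v hv)
    refine ⟨List.nodup_cons.2 ⟨fun hm => lt_irrefl _ (h3 _ hm), ?_⟩, h3⟩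
    simpa using h1

/-- The rank of a vertex is the number of vertices from which it can be reached by a nonempty walk.
Across an arc this set gains the tail, which by acyclicity does not belong to its own set. -/
theorem AcyclicSupport.exists_rank [Fintype V] {x : A → ℝ} (h : AcyclicSupport D x) :
    ∃ r : V → ℕ, Ranked D x r ∧ ∀ v, r v ≤ Fintype.card V := by
  let E : V → V → Prop := fun u w => ∃ a, 0 < x a ∧ D.tail a = u ∧ D.head a = w
  refine ⟨fun v => (Finset.univ.filter fun u => Relation.TransGen E u v).card, ?_,
    fun v => Finset.card_le_univ _⟩
  intro a ha
  have hE : E (D.tail a) (D.head a) := ⟨a, ha, rfl, rfl⟩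
  apply Finset.card_lt_card
  refine (Finset.ssubset_iff_of_subset ?_).2 ⟨D.tail a, ?_, ?_⟩
  · intro u hu
    simp only [Finset.mem_filter, Finset.mem_univ, true_and] at hu ⊢
    exact hu.tail hE
  · simpa using Relation.TransGen.single hE
  · simpa using h (D.tail a)

theorem exists_isWalk_of_transGen {x : A → ℝ} {u w : V}
    (h : Relation.TransGen (fun u w => ∃ a, 0 < x a ∧ D.tail a = u ∧ D.head a = w) u w) :
    ∃ l : List A, l ≠ [] ∧ IsWalk D u l w ∧ ∀ a ∈ l, 0 < x a := by
  induction h with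
  | single h =>
    obtain ⟨a, ha, rfl, rfl⟩ := h
    exact ⟨[a], by simp, ⟨rfl, rfl⟩, by simpa⟩
  | tail _ h ih =>
    obtain ⟨a, ha, rfl, rfl⟩ := h
    obtain ⟨l, -, hl, hx⟩ := ih
    refine ⟨l ++ [a], by simp, hl.append ⟨rfl, rfl⟩, ?_⟩
    simp only [List.mem_append, List.mem_singleton]
    rintro c (hc | rfl)
    · exact hx c hc
    · exact ha

/-- Two paths to the same vertex along arcs no two of which have the same tail coincide. -/
theorem IsPath.eq_of_deterministic {u w : V} {l₁ l₂ : List A} (h₁ : IsPath D u l₁ w)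
    (h₂ : IsPath D u l₂ w)
    (hd : ∀ a ∈ l₁, ∀ a' ∈ l₂, D.tail a = D.tail a' → a = a') : l₁ = l₂ := by
  -- A nonempty path cannot end where it starts; this prevents one of the two paths from stopping
  -- while the other passes on through `w`.
  have key : ∀ (u : V) (a : A) (l : List A), IsPath D u (a :: l) w → u ≠ w := by
    rintro u a l ⟨hw, hn⟩ rfl
    rw [List.nodup_cons] at hn
    apply hn.1
    clear hn h₁ h₂ hd
    have : ∀ (l : List A) (a : A) (z : V), IsWalk D z (a :: l) u →
        u ∈ (a :: l).map D.head := by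
      intro l
      induction l with
      | nil => rintro a z ⟨-, h⟩; cases h; simp
      | cons c l ih =>
        rintro a z ⟨-, h⟩
        rw [List.map_cons]
        exact List.mem_cons_of_mem _ (ih _ _ h)
    exact this l a u hw
  induction l₁ generalizing u l₂ with
  | nil =>
    cases l₂ with
    | nil => rfl
    | cons a l => exact absurd h₁.1 (key _ _ _ h₂)
  | cons a l ih =>
    cases l₂ with
    | nil => exact absurd h₂.1 (key _ _ _ h₁)
    | cons a' l' =>
      have : a = a' := hd a List.mem_cons_self a' List.mem_cons_self (h₁.1.1.trans h₂.1.1.symm)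
      subst this
      congr 1
      refine ih ⟨h₁.1.2, ?_⟩ ⟨h₂.1.2, ?_⟩ fun c hc c' hc' =>
        hd c (List.mem_cons_of_mem _ hc) c' (List.mem_cons_of_mem _ hc')
      · have := h₁.2; rw [List.nodup_cons] at this; simpa using this.2
      · have := h₂.2; rw [List.nodup_cons] at this; simpa using this.2

/-- Interchange of summation: it turns a sum over all arcs, with a path or cycle written as a list
of pulses, into a sum along that list, where telescoping applies. -/
theorem sum_pulse_mul {ι E : Type*} [Fintype E] (L : List ι) (arc : ι → E) (w : ι → ℝ)
    (g : E → ℝ) :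
    ∑ e, (L.map fun p => if arc p = e then w p else 0).sum * g e =
      (L.map fun p => w p * g (arc p)).sum := by
  induction L with
  | nil => simp
  | cons p L ih =>
    simp only [List.map_cons, List.sum_cons, add_mul, Finset.sum_add_distrib, ih]
    simp [ite_mul]

theorem sum_pulse_of_nodup {E : Type*} {L : List E} (hL : L.Nodup) (w : ℝ) (e : E) :
    (L.map fun p => if p = e then w else 0).sum = if e ∈ L then w else 0 := by
  induction L with
  | nil => simp
  | cons p L ih =>
    rw [List.nodup_cons] at hL
    rw [List.map_cons, List.sum_cons, ih hL.2]
    by_cases h : p = e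
    · subst h; simp [hL.1]
    · simp [h, Ne.symm h]

theorem one_le_congestionFactor (c x : A → ℝ) : 1 ≤ congestionFactor c x := le_max_left _ _

end Walks

/-! ### Optimal fractional transshipments -/

section Optimal

variable {V : Type u} {A : Type v} [Fintype A] {D : Net V A} {b : V → ℝ}

theorem isTransshipment_iff {x : A → ℝ} :
    IsTransshipment D b x ↔ (∀ a, 0 ≤ x a) ∧
      ∀ v, ∑ a, x a * ((if D.tail a = v then 1 else 0) - (if D.head a = v then 1 else 0)) = b v := by
  unfold IsTransshipment
  simp [Finset.sum_filter, mul_sub]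

theorem congestionFactor_le_iff {c x : A → ℝ} (hc : ∀ a, 0 < c a) {α : ℝ} (hα : 1 ≤ α) :
    congestionFactor c x ≤ α ↔ ∀ a, x a ≤ α * c a := by
  unfold congestionFactor congestion
  rw [max_le_iff]
  constructor
  · rintro ⟨-, h⟩ a
    rw [← div_le_iff₀ (hc a)]
    exact (le_ciSup (Finite.bddAbove_range _) a).trans h
  · intro h
    refine ⟨hα, Real.iSup_le (fun a => ?_) (by linarith)⟩
    rw [div_le_iff₀ (hc a)]
    exact h a

theorem le_congestionFactor_mul {c x : A → ℝ} (hc : ∀ a, 0 < c a) (a : A) :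
    x a ≤ congestionFactor c x * c a :=
  (congestionFactor_le_iff hc (one_le_congestionFactor c x)).1 le_rfl a

theorem isClosed_isTransshipment : IsClosed {x : A → ℝ | IsTransshipment D b x} := by
  have : {x : A → ℝ | IsTransshipment D b x} = {x | ∀ a, 0 ≤ x a} ∩
      {x | ∀ v, ∑ a, x a * ((if D.tail a = v then 1 else 0) -
        (if D.head a = v then 1 else 0)) = b v} := by
    ext x; exact isTransshipment_iff
  rw [this]
  refine IsClosed.inter ?_ ?_
  · simp only [Set.ofPred_forall]
    exact isClosed_iInter fun a => isClosed_le continuous_const (continuous_apply a)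
  · simp only [Set.ofPred_forall]
    exact isClosed_iInter fun v => isClosed_eq (by fun_prop) continuous_const

/-- Cancelling as much flow as possible along a closed walk keeps all balances and lowers the total
flow. -/
theorem exists_smaller_of_not_acyclicSupport {x : A → ℝ} (hx : IsTransshipment D b x)
    (h : ¬ AcyclicSupport D x) :
    ∃ x', IsTransshipment D b x' ∧ (∀ a, x' a ≤ x a) ∧ ∑ a, x' a < ∑ a, x a := by
  unfold AcyclicSupport at h
  push Not at h
  obtain ⟨v, hv⟩ := h
  obtain ⟨l, hl, hw, hpos⟩ := exists_isWalk_of_transGen hv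
  -- The closed walk may repeat arcs, so `z` counts multiplicities.
  let z : A → ℝ := fun a => (l.map fun p => if p = a then (1 : ℝ) else 0).sum
  have hz0 : ∀ a, 0 ≤ z a := fun a => List.sum_nonneg (by
    simp only [List.mem_map]; rintro _ ⟨p, -, rfl⟩; split_ifs <;> norm_num)
  have hzx : ∀ a, 0 < z a → 0 < x a := by
    intro a ha
    by_contra hxa
    have : a ∉ l := fun hm => hxa (hpos a hm)
    have h0 : z a = 0 := by
      apply List.sum_eq_zero
      simp only [List.mem_map]
      rintro _ ⟨p, hp, rfl⟩
      rw [if_neg]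
      rintro rfl; exact this hp
    linarith
  have hzsum : 0 < ∑ a, z a := by
    have := sum_pulse_mul l id (fun _ => (1 : ℝ)) fun _ => 1
    simp only [mul_one, id] at this
    change ∑ a, z a = _ at this
    rw [this]
    simpa using List.length_pos_iff.2 hl
  obtain ⟨a₀, -, ha₀⟩ := Finset.exists_lt_of_sum_lt (s := Finset.univ) (f := fun _ : A => (0 : ℝ))
    (g := z) (by simpa using hzsum)
  obtain ⟨a₁, h₁, hmin⟩ := Finset.exists_min_image (Finset.univ.filter fun a => 0 < z a)
    (fun a => x a / z a) ⟨a₀, by simpa using ha₀⟩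
  simp only [Finset.mem_filter, Finset.mem_univ, true_and] at h₁ hmin
  -- The largest multiple of `z` that can be subtracted without making an arc negative.
  set ε := x a₁ / z a₁ with hε
  have hεpos : 0 < ε := div_pos (hzx _ h₁) h₁
  refine ⟨fun a => x a - ε * z a, isTransshipment_iff.2 ⟨fun a => ?_, fun w => ?_⟩, fun a => ?_, ?_⟩
  · rcases (hz0 a).eq_or_lt with h | h
    · rw [← h]; simpa using hx.1 a
    · have := (le_div_iff₀ h).1 (hmin a h)
      linarith
  · have h1 := (isTransshipment_iff.1 hx).2 w
    have h2 := sum_pulse_mul l id (fun _ => (1 : ℝ))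
      fun a => ((if D.tail a = w then 1 else 0) - (if D.head a = w then 1 else 0))
    have h3 := hw.sum_sub fun u => if u = w then (-1 : ℝ) else 0
    simp only [sub_self, id, one_mul] at h2 h3
    have h4 : (l.map fun a => ((if D.tail a = w then (1 : ℝ) else 0) -
        (if D.head a = w then 1 else 0))).sum = 0 := by
      refine Eq.trans ?_ h3
      congr 1
      refine List.map_congr_left fun a _ => ?_
      split_ifs <;> norm_num
    rw [h4] at h2
    change ∑ a, z a * _ = 0 at h2
    simp only [sub_mul, mul_assoc, Finset.sum_sub_distrib, ← Finset.mul_sum]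
    rw [h2, h1]; ring
  · have := mul_nonneg hεpos.le (hz0 a)
    simp only; linarith
  · rw [Finset.sum_sub_distrib, ← Finset.mul_sum]
    have := mul_pos hεpos hzsum
    linarith

/-- Two successive minimizations over compact sets: the factor, and then the total flow among the
optimal solutions. A remaining flow-carrying cycle would contradict the second one. -/
theorem exists_isOptimalFractional_of_capacity_pos {c : A → ℝ} (hc : ∀ a, 0 < c a)
    {x₀ : A → ℝ} (hx₀ : IsTransshipment D b x₀) : ∃ x, IsOptimalFractional D b c x := by
  -- The factor is carried as an extra coordinate, so that the objective is a projection and the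
  -- constraints are closed.
  let F : Set (ℝ × (A → ℝ)) := {p | 1 ≤ p.1 ∧ IsTransshipment D b p.2 ∧ ∀ a, p.2 a ≤ p.1 * c a}
  have hF : IsClosed F := by
    refine IsClosed.and (isClosed_le continuous_const continuous_fst) (IsClosed.and
      (isClosed_isTransshipment.preimage continuous_snd) ?_)
    simp only [Set.ofPred_forall]
    exact isClosed_iInter fun a => isClosed_le (by fun_prop) (by fun_prop)
  have hmem : ∀ x, IsTransshipment D b x → (congestionFactor c x, x) ∈ F := fun x hx =>
    ⟨one_le_congestionFactor c x, hx, le_congestionFactor_mul hc⟩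
  have hcomp : ∀ β : ℝ, IsCompact (F ∩ {p | p.1 ≤ β}) := by
    intro β
    refine (isCompact_Icc (a := ((1 : ℝ), (0 : A → ℝ))) (b := (β, fun a => β * c a))).of_isClosed_subset
      (hF.inter (isClosed_le continuous_fst continuous_const)) ?_
    rintro ⟨α, x⟩ ⟨⟨h1, h2, h3⟩, h4⟩
    refine ⟨⟨h1, h2.1⟩, h4, fun a => (h3 a).trans ?_⟩
    exact mul_le_mul_of_nonneg_right h4 (hc a).le
  obtain ⟨⟨α, x₁⟩, hα, hmin⟩ := (hcomp (congestionFactor c x₀)).exists_isMinOn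
    ⟨_, hmem x₀ hx₀, le_refl (congestionFactor c x₀)⟩ continuous_fst.continuousOn
  have hmin' : ∀ x, IsTransshipment D b x → α ≤ congestionFactor c x := by
    intro x hx
    by_cases h : congestionFactor c x ≤ congestionFactor c x₀
    · exact hmin (show (congestionFactor c x, x) ∈ _ from ⟨hmem x hx, h⟩)
    · exact hα.2.trans (not_le.1 h).le
  obtain ⟨⟨β, x⟩, hβ, hmin₂⟩ := (hcomp α).exists_isMinOn (f := fun p => ∑ a, p.2 a)
    ⟨_, hα.1, le_refl α⟩ (by fun_prop)
  have hα1 : 1 ≤ α := hα.1.1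
  refine ⟨x, hβ.1.2.1, ?_, fun x' hx' => ?_⟩
  · by_contra hac
    obtain ⟨x', h1, h2, h3⟩ := exists_smaller_of_not_acyclicSupport hβ.1.2.1 hac
    have : ∑ a, x a ≤ ∑ a, x' a :=
      hmin₂ (show (β, x') ∈ _ from ⟨⟨hβ.1.1, h1, fun a => (h2 a).trans (hβ.1.2.2 a)⟩, hβ.2⟩)
    linarith
  · refine le_trans ?_ (hmin' x' hx')
    rw [congestionFactor_le_iff hc hα1]
    intro a
    exact (hβ.1.2.2 a).trans (mul_le_mul_of_nonneg_right hβ.2 (hc a).le)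

theorem IsTransshipment.sum_eq_zero [Fintype V] {x : A → ℝ} (hx : IsTransshipment D b x) :
    ∑ v, b v = 0 := by
  simp only [← (isTransshipment_iff.1 hx).2]
  rw [Finset.sum_comm]
  simp [← Finset.mul_sum]

/-- The balance condition forces positive capacities only when there is a sink. Without sinks all
balances are nonnegative with sum zero, hence vanish, and the zero flow attains the least possible
factor 1. -/
theorem exists_isOptimalFractional [Fintype V] {c : A → ℝ} (hb : BalanceCondition b c)
    {x₀ : A → ℝ} (hx₀ : IsTransshipment D b x₀) : ∃ x, IsOptimalFractional D b c x := by
  by_cases h : ∃ t, b t < 0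
  · obtain ⟨t, ht⟩ := h
    exact exists_isOptimalFractional_of_capacity_pos
      (fun a => (abs_pos.2 ht.ne).trans_le (hb t ht a)) hx₀
  · push Not at h
    have h0 : ∀ v, b v = 0 := fun v =>
      (Finset.sum_eq_zero_iff_of_nonneg fun v _ => h v).1 hx₀.sum_eq_zero v (Finset.mem_univ v)
    refine ⟨0, ⟨by simp, by simp [h0]⟩, ?_, fun x' _ => ?_⟩
    · intro v hv
      obtain ⟨l, hl, -, hp⟩ := exists_isWalk_of_transGen hv
      obtain ⟨a, ha⟩ := List.exists_mem_of_ne_nil l hl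
      simpa using hp a ha
    · refine (max_le le_rfl ?_).trans (one_le_congestionFactor c x')
      exact Real.iSup_le (fun a => by simp) zero_le_one

/-- The ratio on an arc grows by at most 1, which is at most the factor of `x`. An arc of capacity
zero has ratio zero by the convention for division. -/
theorem congestionFactor_le_two_mul {c x y : A → ℝ} (hc : ∀ a, 0 ≤ c a)
    (h : ∀ a, y a ≤ x a + c a) : congestionFactor c y ≤ 2 * congestionFactor c x := by
  have h1 := one_le_congestionFactor c x
  refine max_le (by linarith) (Real.iSup_le (fun a => ?_) (by linarith))
  have h2 : x a / c a ≤ congestionFactor c x :=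
    (le_ciSup (f := fun a => x a / c a) (Finite.bddAbove_range _) a).trans (le_max_right _ _)
  rcases (hc a).eq_or_lt with h0 | h0
  · rw [← h0]; simp; linarith
  · calc y a / c a ≤ (x a + c a) / c a := by gcongr; exact h a
      _ = x a / c a + 1 := by field_simp
      _ ≤ _ := by linarith

end Optimal

/-! ### Flow balance in the extended network -/

section Balance

variable {V : Type u} {A : Type v} {D : Net V A} {b : V → ℝ}

theorem sum_eq_sum_add_sub {ι : Type*} [Fintype ι] {F F' : ι → ℝ} (i : ι)
    (h : ∀ j, j ≠ i → F' j = F j) : ∑ j, F' j = ∑ j, F j + (F' i - F i) := by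
  rw [← Finset.add_sum_erase _ F (Finset.mem_univ i), ← Finset.add_sum_erase _ F' (Finset.mem_univ i),
    Finset.sum_congr rfl fun j hj => h j (Finset.ne_of_mem_erase hj)]
  ring

/-- Incidence of a vertex with an arc: `1` at the head and `-1` at the tail. -/
noncomputable def incidence (D : Net V A) (b : V → ℝ) (v : V) (e : SArc A b) : ℝ :=
  (if shead D b e = v then 1 else 0) - (if stail D b e = some v then 1 else 0)

theorem incidence_inl (v : V) (a : A) : incidence D b v (.inl a) =
    (if D.head a = v then 1 else 0) - (if D.tail a = v then 1 else 0) := by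
  by_cases h1 : D.head a = v <;> by_cases h2 : D.tail a = v <;>
    simp [incidence, shead, stail, h1, h2]

theorem incidence_inr (v : V) (s : {s : V // 0 < b s}) : incidence D b v (.inr s) =
    if s.1 = v then 1 else 0 := by
  by_cases h1 : s.1 = v <;> simp [incidence, shead, stail, h1]

variable [Fintype V] [Fintype A]

/-- Total flow on the arcs entering `v`. -/
noncomputable def inflow (D : Net V A) (b : V → ℝ) (y : SArc A b → ℝ) (v : V) : ℝ :=
  ∑ e, if shead D b e = v then y e else 0

/-- Total flow on the arcs leaving `v`. -/
noncomputable def outflow (D : Net V A) (b : V → ℝ) (y : SArc A b → ℝ) (v : V) : ℝ :=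
  ∑ e, if stail D b e = some v then y e else 0

/-- Inflow minus outflow. -/
noncomputable def net (D : Net V A) (b : V → ℝ) (y : SArc A b → ℝ) (v : V) : ℝ :=
  ∑ e, y e * incidence D b v e

theorem net_eq (y : SArc A b → ℝ) (v : V) : net D b y v = inflow D b y v - outflow D b y v := by
  simp [net, inflow, outflow, incidence, mul_sub]

theorem le_inflow {y : SArc A b → ℝ} (hy : ∀ e, 0 ≤ y e) {e : SArc A b} {v : V}
    (he : shead D b e = v) : y e ≤ inflow D b y v := by
  have := Finset.single_le_sum (f := fun e => if shead D b e = v then y e else 0)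
    (fun i _ => by split_ifs; exacts [hy i, le_rfl]) (Finset.mem_univ e)
  simp only [he, if_true] at this
  exact this

theorem add_le_inflow {y : SArc A b → ℝ} (hy : ∀ e, 0 ≤ y e) {e e' : SArc A b} (hne : e ≠ e') {v : V}
    (he : shead D b e = v) (he' : shead D b e' = v) : y e + y e' ≤ inflow D b y v := by
  have := Finset.sum_le_sum_of_subset_of_nonneg
    (f := fun e => if shead D b e = v then y e else 0) (Finset.subset_univ {e, e'})
    (fun i _ _ => by split_ifs; exacts [hy i, le_rfl])
  rw [Finset.sum_pair hne] at this
  simp only [he, he', if_true] at this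
  exact this

theorem le_outflow {y : SArc A b → ℝ} (hy : ∀ e, 0 ≤ y e) {e : SArc A b} {v : V}
    (he : stail D b e = some v) : y e ≤ outflow D b y v := by
  have := Finset.single_le_sum (f := fun e => if stail D b e = some v then y e else 0)
    (fun i _ => by split_ifs; exacts [hy i, le_rfl]) (Finset.mem_univ e)
  simp only [he, if_true] at this
  exact this

theorem outflow_nonneg {y : SArc A b → ℝ} (hy : ∀ e, 0 ≤ y e) (v : V) : 0 ≤ outflow D b y v :=
  Finset.sum_nonneg fun i _ => by split_ifs; exacts [hy i, le_rfl]

theorem exists_of_inflow_pos {y : SArc A b → ℝ} {v : V} (h : 0 < inflow D b y v) :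
    ∃ e, shead D b e = v ∧ 0 < y e := by
  obtain ⟨e, -, he⟩ := Finset.exists_lt_of_sum_lt (s := Finset.univ)
    (f := fun _ : SArc A b => (0 : ℝ)) (g := fun e => if shead D b e = v then y e else 0)
    (by simp only [Finset.sum_const_zero]; exact h)
  refine ⟨e, ?_⟩
  split_ifs at he with h1
  · exact ⟨h1, he⟩
  · exact absurd he (lt_irrefl _)

/-- If more flow enters `v` than an arc `a'` carries, then another arc enters `v`. -/
theorem exists_ne_of_lt_inflow {y : SArc A b → ℝ} {v : V} {a' : SArc A b}
    (ha' : shead D b a' = v) (h : y a' < inflow D b y v) :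
    ∃ e, e ≠ a' ∧ shead D b e = v ∧ 0 < y e := by
  by_contra hcon
  push Not at hcon
  have : inflow D b y v ≤ ∑ e, if e = a' then y e else 0 := by
    refine Finset.sum_le_sum fun e _ => ?_
    by_cases h1 : e = a'
    · simp [h1, ha']
    · simp only [h1, if_false]
      split_ifs with h2
      · exact hcon e h1 h2
      · exact le_rfl
  simp at this
  linarith

theorem exists_of_outflow_pos {y : SArc A b → ℝ} {v : V} (h : 0 < outflow D b y v) :
    ∃ e, stail D b e = some v ∧ 0 < y e := by
  obtain ⟨e, -, he⟩ := Finset.exists_lt_of_sum_lt (s := Finset.univ)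
    (f := fun _ : SArc A b => (0 : ℝ)) (g := fun e => if stail D b e = some v then y e else 0)
    (by simp only [Finset.sum_const_zero]; exact h)
  refine ⟨e, ?_⟩
  split_ifs at he with h1
  · exact ⟨h1, he⟩
  · exact absurd he (lt_irrefl _)

theorem outflow_eq_of_funnel {y : SArc A b → ℝ} (hy : ∀ e, 0 ≤ y e) {v : V}
    (hf : Funnel D b y v) {e : SArc A b} (he : stail D b e = some v) (hpos : 0 < y e) :
    outflow D b y v = y e := by
  unfold outflow
  rw [Finset.sum_eq_single e]
  · simp [he]
  · intro e' _ hne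
    split_ifs with h
    · by_contra h0
      exact hne (hf ⟨lt_of_le_of_ne (hy e') (Ne.symm h0), h⟩ ⟨hpos, he⟩)
    · rfl
  · simp

theorem outflow_eq_zero {y : SArc A b → ℝ} (hy : ∀ e, 0 ≤ y e) {v : V}
    (h : outArcs D b y (some v) = ∅) : outflow D b y v = 0 := by
  by_contra h0
  obtain ⟨e, he, hpos⟩ := exists_of_outflow_pos (lt_of_le_of_ne (outflow_nonneg hy v) (Ne.symm h0))
  exact (h ▸ (⟨hpos, he⟩ : e ∈ outArcs D b y (some v)) : e ∈ (∅ : Set _))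

theorem net_update (y : SArc A b → ℝ) (e : SArc A b) (d : ℝ) (v : V) :
    net D b (Function.update y e (y e - d)) v = net D b y v - d * incidence D b v e := by
  unfold net
  rw [sum_eq_sum_add_sub (F := fun e => y e * incidence D b v e) e]
  · simp; ring
  · intro j hj
    simp [hj]

/-- The common form of the two flow changes made along a list of arcs: removing a path and
augmenting along an alternating cycle. -/
theorem net_add_pulse {ι : Type*} (L : List ι) (arc : ι → SArc A b) (w : ι → ℝ)
    {y y' : SArc A b → ℝ}
    (h : ∀ e, y' e = y e + (L.map fun p => if arc p = e then w p else 0).sum) (v : V) :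
    net D b y' v = net D b y v + (L.map fun p => w p * incidence D b v (arc p)).sum := by
  unfold net
  rw [← sum_pulse_mul, ← Finset.sum_add_distrib]
  exact Finset.sum_congr rfl fun e _ => by rw [h]; ring_nf

end Balance

/-! ### Invariants that hold throughout the algorithm -/

section Core

variable {V : Type u} {A : Type v} {D : Net V A} {b : V → ℝ}

/-- Total demand of the tokens located at `v`. -/
noncomputable def demandAt [Fintype V] (pos : V → V) (dem : V → ℝ) (v : V) : ℝ :=
  ∑ t, if pos t = v then dem t else 0

/-- Total demand of the tokens whose trail uses `a`. -/
noncomputable def trailLoad [Fintype V] (trail : V → List A) (dem : V → ℝ) (a : A) : ℝ :=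
  ∑ t, if a ∈ trail t then dem t else 0

/-- The flow routed along `a` so far. -/
noncomputable def load [Fintype V] (σ : State V A b) (a : A) : ℝ :=
  totalFlow σ.routed a + trailLoad σ.trail σ.dem a

theorem demandAt_update_pos [Fintype V] (pos : V → V) (dem : V → ℝ) (t u v : V) :
    demandAt (Function.update pos t u) dem v =
      demandAt pos dem v + ((if u = v then dem t else 0) - if pos t = v then dem t else 0) := by
  refine (sum_eq_sum_add_sub (F := fun t => if pos t = v then dem t else 0) t
    fun j hj => by simp [hj]).trans ?_
  simp [demandAt]

theorem demandAt_update_dem [Fintype V] (pos : V → V) (dem : V → ℝ) (t v : V) (d : ℝ) :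
    demandAt pos (Function.update dem t d) v =
      demandAt pos dem v + if pos t = v then d - dem t else 0 := by
  refine (sum_eq_sum_add_sub (F := fun t => if pos t = v then dem t else 0) t
    fun j hj => by simp [hj]).trans ?_
  by_cases h : pos t = v <;> simp [demandAt, h]

theorem trailLoad_update_trail [Fintype V] (trail : V → List A) (dem : V → ℝ) (t : V)
    (l : List A) (a : A) : trailLoad (Function.update trail t l) dem a =
      trailLoad trail dem a + ((if a ∈ l then dem t else 0) - if a ∈ trail t then dem t else 0) := by
  refine (sum_eq_sum_add_sub (F := fun t => if a ∈ trail t then dem t else 0) t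
    fun j hj => by simp [hj]).trans ?_
  simp [trailLoad]

theorem trailLoad_update_dem [Fintype V] (trail : V → List A) (dem : V → ℝ) (t : V) (d : ℝ)
    (a : A) : trailLoad trail (Function.update dem t d) a =
      trailLoad trail dem a + if a ∈ trail t then d - dem t else 0 := by
  refine (sum_eq_sum_add_sub (F := fun t => if a ∈ trail t then dem t else 0) t
    fun j hj => by simp [hj]).trans ?_
  by_cases h : a ∈ trail t <;> simp [trailLoad, h]

theorem moveAlong_y (σ : State V A b) (t : V) (e : SArc A b) :
    (moveAlong D b σ t e).y = Function.update σ.y e (σ.y e - σ.dem t) := by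
  cases e <;> rfl

/-- Loads test membership in a list, so an arc already on the trail would not be counted again;
hence only an inequality. Along a dummy arc, load passes from the trail to the routed path and does
not grow. -/
theorem load_moveAlong_le [Fintype V] {σ : State V A b} {t : V} (h : 0 ≤ σ.dem t) (e : SArc A b)
    (a : A) : load (moveAlong D b σ t e) a ≤ load σ a + if e = .inl a then σ.dem t else 0 := by
  cases e with
  | inl c =>
    simp only [load, UnsplitTrans.moveAlong, trailLoad_update_trail, List.mem_cons, Sum.inl.injEq]
    by_cases h1 : c = a
    · subst h1; simp; split_ifs <;> linarith
    · simp [h1, Ne.symm h1]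
  | inr s =>
    simp only [load, UnsplitTrans.moveAlong, totalFlow, List.map_cons, List.sum_cons,
      trailLoad_update_dem, reduceCtorEq, if_false]
    split_ifs <;> linarith

theorem load_sendBack_le [Fintype V] {σ : State V A b} {t : V} {s : {s : V // 0 < b s}}
    {l : List A} {ε : ℝ} (hε : 0 ≤ ε) (a : A) :
    load (sendBack σ t s l ε) a ≤ load σ a + if a ∈ l then ε else 0 := by
  simp only [load, UnsplitTrans.sendBack, totalFlow, List.map_cons, List.sum_cons,
    trailLoad_update_dem, List.mem_append]
  by_cases h1 : a ∈ l <;> by_cases h2 : a ∈ σ.trail t <;> simp [h1, h2] <;> linarith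

variable [Fintype V] [Fintype A]

/-- The properties of a state that hold throughout the algorithm started on `x`. -/
structure Core (D : Net V A) (x : A → ℝ) (σ : State V A b) : Prop where
  nonneg : ∀ e, 0 ≤ σ.y e
  supp : ∀ a, 0 < σ.y (.inl a) → 0 < x a
  dem_nonneg : ∀ t, 0 ≤ σ.dem t
  dem_le : ∀ t, σ.dem t ≤ max (-b t) 0
  cons : ∀ v, net D b σ.y v = demandAt σ.pos σ.dem v
  trail_walk : ∀ t, IsWalk D (σ.pos t) (σ.trail t) t
  trail_supp : ∀ t, ∀ a ∈ σ.trail t, 0 < x a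
  src : ∀ s : {s : V // 0 < b s},
    (σ.routed.map fun p => if p.source = s.1 then p.amount else 0).sum + σ.y (.inr s) = b s.1
  snk : ∀ t, (σ.routed.map fun p => if p.sink = t then p.amount else 0).sum + σ.dem t =
    max (-b t) 0
  source_pos : ∀ p ∈ σ.routed, 0 < b p.source
  sink_neg : ∀ p ∈ σ.routed, b p.sink < 0
  amount_pos : ∀ p ∈ σ.routed, 0 < p.amount
  walk : ∀ p ∈ σ.routed, IsWalk D p.source p.arcs p.sink
  arcs_supp : ∀ p ∈ σ.routed, ∀ a ∈ p.arcs, 0 < x a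

variable {x : A → ℝ} {σ : State V A b}

theorem Core.sink_neg_of_dem_pos (h : Core D x σ) {t : V} (ht : 0 < σ.dem t) : b t < 0 := by
  have := ht.trans_le (h.dem_le t)
  rcases lt_max_iff.1 this with h | h
  · linarith
  · exact absurd h (lt_irrefl _)

theorem Core.of_flow {y' : SArc A b → ℝ} (h : Core D x σ) (h0 : ∀ e, 0 ≤ y' e)
    (hs : ∀ a, 0 < y' (.inl a) → 0 < σ.y (.inl a)) (hn : ∀ v, net D b y' v = net D b σ.y v)
    (hr : ∀ s, y' (.inr s) = σ.y (.inr s)) : Core D x { σ with y := y' } where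
  nonneg := h0
  supp a ha := h.supp a (hs a ha)
  dem_nonneg := h.dem_nonneg
  dem_le := h.dem_le
  cons v := (hn v).trans (h.cons v)
  trail_walk := h.trail_walk
  trail_supp := h.trail_supp
  src s := by simpa only [hr] using h.src s
  snk := h.snk
  source_pos := h.source_pos
  sink_neg := h.sink_neg
  amount_pos := h.amount_pos
  walk := h.walk
  arcs_supp := h.arcs_supp

theorem Core.moveAlong (h : Core D x σ) {t : V} {e : SArc A b} (ht : 0 < σ.dem t)
    (he : shead D b e = σ.pos t) (hle : σ.dem t ≤ σ.y e) :
    Core D x (moveAlong D b σ t e) := by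
  cases e with
  | inl a =>
    have ha : 0 < x a := h.supp a (ht.trans_le hle)
    exact {
      nonneg := by
        intro e
        simp only [UnsplitTrans.moveAlong, Function.update_apply]
        split_ifs
        · linarith
        · exact h.nonneg e
      supp := by
        intro a' ha'
        simp only [UnsplitTrans.moveAlong, Function.update_apply] at ha'
        split_ifs at ha' with h1
        · cases h1; exact ha
        · exact h.supp a' ha'
      dem_nonneg := h.dem_nonneg
      dem_le := h.dem_le
      cons := by
        intro v
        simp only [UnsplitTrans.moveAlong]
        rw [net_update, h.cons, demandAt_update_pos]
        simp only [incidence, he, stail, Option.some.injEq]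
        split_ifs <;> ring
      trail_walk := by
        intro t'
        by_cases h1 : t' = t
        · subst h1
          simp only [UnsplitTrans.moveAlong, Function.update_self]
          refine ⟨rfl, ?_⟩
          have := h.trail_walk t'
          rwa [← he] at this
        · simpa [UnsplitTrans.moveAlong, h1] using h.trail_walk t'
      trail_supp := by
        intro t' a' ha'
        by_cases h1 : t' = t
        · subst h1
          simp only [UnsplitTrans.moveAlong, Function.update_self, List.mem_cons] at ha'
          rcases ha' with rfl | ha'
          · exact ha
          · exact h.trail_supp t' a' ha'
        · simp only [UnsplitTrans.moveAlong, Function.update_of_ne h1] at ha'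
          exact h.trail_supp t' a' ha'
      src := by intro s; simpa [UnsplitTrans.moveAlong] using h.src s
      snk := h.snk
      source_pos := h.source_pos
      sink_neg := h.sink_neg
      amount_pos := h.amount_pos
      walk := h.walk
      arcs_supp := h.arcs_supp }
  | inr s =>
    exact {
      nonneg := by
        intro e
        simp only [UnsplitTrans.moveAlong, Function.update_apply]
        split_ifs
        · linarith
        · exact h.nonneg e
      supp := by
        intro a' ha'
        exact h.supp a' (by simpa [UnsplitTrans.moveAlong] using ha')
      dem_nonneg := by
        intro t'
        simp only [UnsplitTrans.moveAlong, Function.update_apply]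
        split_ifs
        exacts [le_rfl, h.dem_nonneg t']
      dem_le := by
        intro t'
        simp only [UnsplitTrans.moveAlong, Function.update_apply]
        split_ifs
        exacts [le_max_right _ _, h.dem_le t']
      cons := by
        intro v
        simp only [UnsplitTrans.moveAlong]
        rw [net_update, h.cons, demandAt_update_dem]
        simp only [incidence, he, stail, reduceCtorEq, if_false]
        split_ifs <;> ring
      trail_walk := h.trail_walk
      trail_supp := h.trail_supp
      src := by
        intro s'
        have := h.src s'
        simp only [UnsplitTrans.moveAlong, List.map_cons, List.sum_cons]
        by_cases h1 : s' = s
        · subst h1; simp; linarith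
        · have h2 : s.1 ≠ s'.1 := fun h2 => h1 (Subtype.ext h2.symm)
          simp [h1, h2]; linarith
      snk := by
        intro t'
        have := h.snk t'
        simp only [UnsplitTrans.moveAlong, List.map_cons, List.sum_cons]
        by_cases h1 : t' = t
        · subst h1; simp; linarith
        · simp [h1, Ne.symm h1]; linarith
      source_pos := by
        simp only [UnsplitTrans.moveAlong, List.forall_mem_cons]
        exact ⟨s.2, h.source_pos⟩
      sink_neg := by
        simp only [UnsplitTrans.moveAlong, List.forall_mem_cons]
        exact ⟨h.sink_neg_of_dem_pos ht, h.sink_neg⟩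
      amount_pos := by
        simp only [UnsplitTrans.moveAlong, List.forall_mem_cons]
        exact ⟨ht, h.amount_pos⟩
      walk := by
        simp only [UnsplitTrans.moveAlong, List.forall_mem_cons]
        refine ⟨?_, h.walk⟩
        have := h.trail_walk t
        rwa [← he] at this
      arcs_supp := by
        simp only [UnsplitTrans.moveAlong, List.forall_mem_cons]
        exact ⟨h.trail_supp t, h.arcs_supp⟩ }

/-- Along the path the changes telescope, and the dummy arc compensates the change at the source;
only the final vertex is affected. -/
theorem net_sub_starPath {y : SArc A b → ℝ} {s : {s : V // 0 < b s}} {l : List A} {w : V}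
    (hl : IsWalk D s.1 l w) (hn : l.Nodup) (ε : ℝ) (v : V) :
    net D b (fun e => if e ∈ starPath s l then y e - ε else y e) v =
      net D b y v - if w = v then ε else 0 := by
  let L : List (SArc A b) := .inr s :: l.map .inl
  have hL : L.Nodup := by
    refine List.nodup_cons.2 ⟨by simp, hn.map Sum.inl_injective⟩
  have hmem : ∀ e, e ∈ starPath s l ↔ e ∈ L := by
    intro e
    simp [starPath, L, eq_comm]
  rw [net_add_pulse L id (fun _ => -ε) (y := y)]
  · have := hl.sum_sub fun u => if u = v then (1 : ℝ) else 0
    have h2 : (l.map fun a => incidence D b v (.inl a)).sum =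
        (if w = v then 1 else 0) - (if s.1 = v then 1 else 0) := by
      rw [← this]
      exact congrArg _ (List.map_congr_left fun a _ => incidence_inl v a)
    rw [List.sum_map_mul_left]
    simp only [L, id, List.map_cons, List.sum_cons, List.map_map, Function.comp_def, h2]
    rw [incidence_inr]
    by_cases h3 : w = v <;> simp [h3]
    ring_nf
  · intro e
    have h5 : (L.map fun p => if id p = e then -ε else 0).sum = if e ∈ L then -ε else 0 := by
      convert sum_pulse_of_nodup hL (-ε) e using 5
      rfl
    rw [h5]
    by_cases h3 : e ∈ starPath s l
    · rw [if_pos h3, if_pos ((hmem e).1 h3)]; ring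
    · rw [if_neg h3, if_neg fun h4 => h3 ((hmem e).2 h4)]; ring

theorem Core.sendBack {r : V → ℕ} (hr : Ranked D x r) (h : Core D x σ) {t : V}
    {s : {s : V // 0 < b s}} {l : List A} {ε : ℝ} (hε : 0 < ε) (ht : ε ≤ σ.dem t)
    (hl : IsWalk D s.1 l (σ.pos t)) (hle : ∀ e ∈ starPath s l, ε ≤ σ.y e) :
    Core D x (sendBack σ t s l ε) := by
  have hsupp : ∀ a ∈ l, 0 < x a := fun a ha =>
    h.supp a (hε.trans_le (hle _ (Or.inr ⟨a, ha, rfl⟩)))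
  have hnodup : l.Nodup := (List.nodup_cons.1 (hl.isPath hr hsupp).2).2.of_map
  exact {
    nonneg := by
      intro e
      simp only [UnsplitTrans.sendBack]
      split_ifs with h1
      · linarith [hle e h1]
      · exact h.nonneg e
    supp := by
      intro a ha
      simp only [UnsplitTrans.sendBack] at ha
      split_ifs at ha with h1
      · exact h.supp a (hε.trans_le (hle _ h1))
      · exact h.supp a ha
    dem_nonneg := by
      intro t'
      simp only [UnsplitTrans.sendBack, Function.update_apply]
      split_ifs
      exacts [by linarith, h.dem_nonneg t']
    dem_le := by
      intro t'
      have := h.dem_le t'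
      simp only [UnsplitTrans.sendBack, Function.update_apply]
      split_ifs with h1
      · subst h1; linarith
      · exact this
    cons := by
      intro v
      simp only [UnsplitTrans.sendBack]
      rw [net_sub_starPath hl hnodup, h.cons, demandAt_update_dem]
      split_ifs <;> ring
    trail_walk := h.trail_walk
    trail_supp := h.trail_supp
    src := by
      intro s'
      have := h.src s'
      simp only [UnsplitTrans.sendBack, List.map_cons, List.sum_cons]
      by_cases h1 : s' = s
      · subst h1; simp [starPath]; linarith
      · have h2 : s.1 ≠ s'.1 := fun h2 => h1 (Subtype.ext h2.symm)
        simp [starPath, h1, h2]; linarith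
    snk := by
      intro t'
      have := h.snk t'
      simp only [UnsplitTrans.sendBack, List.map_cons, List.sum_cons]
      by_cases h1 : t' = t
      · subst h1; simp; linarith
      · simp [h1, Ne.symm h1]; linarith
    source_pos := by
      simp only [UnsplitTrans.sendBack, List.forall_mem_cons]
      exact ⟨s.2, h.source_pos⟩
    sink_neg := by
      simp only [UnsplitTrans.sendBack, List.forall_mem_cons]
      exact ⟨h.sink_neg_of_dem_pos (hε.trans_le ht), h.sink_neg⟩
    amount_pos := by
      simp only [UnsplitTrans.sendBack, List.forall_mem_cons]
      exact ⟨hε, h.amount_pos⟩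
    walk := by
      simp only [UnsplitTrans.sendBack, List.forall_mem_cons]
      exact ⟨hl.append (h.trail_walk t), h.walk⟩
    arcs_supp := by
      simp only [UnsplitTrans.sendBack, List.forall_mem_cons, List.mem_append]
      exact ⟨fun a ha => ha.elim (hsupp a) (h.trail_supp t a), h.arcs_supp⟩ }

end Core

/-! ### Invariants of the move phase and of the search phase -/

section Invariants

variable {V : Type u} {A : Type v} {D : Net V A} {b : V → ℝ}

/-- The heads of present arcs of `S` are funnel vertices whose outgoing arcs belong to `S`. -/
def ClosedArcs (D : Net V A) (b : V → ℝ) (y : SArc A b → ℝ) (S : Set (SArc A b)) : Prop :=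
  ∀ e ∈ S, 0 < y e → Funnel D b y (shead D b e) ∧ outArcs D b y (some (shead D b e)) ⊆ S

theorem ClosedArcs.mono {y y' : SArc A b → ℝ} {S : Set (SArc A b)} (h : ClosedArcs D b y S)
    (hs : ∀ e, 0 < y' e → 0 < y e) : ClosedArcs D b y' S := by
  intro e he hpos
  obtain ⟨h1, h2⟩ := h e he (hs e hpos)
  exact ⟨fun a ha c hc => h1 ⟨hs a ha.1, ha.2⟩ ⟨hs c hc.1, hc.2⟩, fun a ha => h2 ⟨hs a ha.1, ha.2⟩⟩

theorem closedArcs_singular (y : SArc A b → ℝ) : ClosedArcs D b y (singular D b y) := by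
  refine fun e he _ => ⟨he _ .refl, fun e' he' w hw => he w ?_⟩
  exact .head ⟨e', he'.1, he'.2, rfl⟩ hw

/-- Closedness is a local condition that survives deletion of arcs, and it propagates along
reachability. Thus present arcs with an old label are still singular when labels are computed
afresh. -/
theorem ClosedArcs.subset_singular {y : SArc A b → ℝ} {S : Set (SArc A b)}
    (h : ClosedArcs D b y S) {e : SArc A b} (he : e ∈ S) (hpos : 0 < y e) :
    e ∈ singular D b y := by
  intro w hw
  suffices ∃ e' ∈ S, 0 < y e' ∧ shead D b e' = w by
    obtain ⟨e', h1, h2, rfl⟩ := this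
    exact (h e' h1 h2).1
  induction hw with
  | refl => exact ⟨e, he, hpos, rfl⟩
  | tail _ h1 ih =>
    obtain ⟨e', h2, h3, rfl⟩ := ih
    obtain ⟨e'', h4, h5, h6⟩ := h1
    exact ⟨e'', (h e' h2 h3).2 ⟨h4, h5⟩, h4, h6⟩

/-- Among the tokens outside `R`, those with smaller demand than the flow on an incoming arc of `S`
are located at vertices without outgoing arcs, at most one at each vertex. -/
structure Regular (D : Net V A) (S : Set (SArc A b)) (R : Set V) (σ : State V A b) : Prop where
  le : ∀ t e e', 0 < σ.dem t → σ.pos t ∉ R → shead D b e = σ.pos t → e ∈ S → 0 < σ.y e' →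
    stail D b e' = some (σ.pos t) → σ.y e ≤ σ.dem t
  unique : ∀ t₁ t₂ e₁ e₂, 0 < σ.dem t₁ → 0 < σ.dem t₂ → σ.pos t₁ ∉ R → σ.pos t₁ = σ.pos t₂ →
    shead D b e₁ = σ.pos t₁ → shead D b e₂ = σ.pos t₂ → e₁ ∈ S → e₂ ∈ S →
    σ.dem t₁ < σ.y e₁ → σ.dem t₂ < σ.y e₂ → t₁ = t₂

/-- No source-sink pair can be served twice. -/
structure PairsOK (σ : State V A b) : Prop where
  nodup : (σ.routed.map fun p => (p.source, p.sink)).Nodup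
  done : ∀ p ∈ σ.routed, σ.dem p.sink = 0 ∨ ∀ s : {s // 0 < b s}, s.1 = p.source → σ.y (.inr s) = 0

/-- Bound on the load of an arc, depending on whether it is labeled singular. -/
def LoadOK [Fintype V] (x : A → ℝ) (S : Set (SArc A b)) (σ : State V A b) (M : ℝ) (a : A) : Prop :=
  load σ a + σ.y (.inl a) ≤ x a ∨ (.inl a ∈ S ∧ load σ a ≤ x a) ∨
    (σ.y (.inl a) = 0 ∧ load σ a ≤ x a + M)

/-- `M` is an upper bound on all demands. -/
def DemandBound (b : V → ℝ) (M : ℝ) : Prop := ∀ t, max (-b t) 0 ≤ M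

variable {S : Set (SArc A b)} {σ : State V A b}

theorem CanMove.dem_le {t : V} {e : SArc A b} (h : CanMove D b S σ t e) : σ.dem t ≤ σ.y e := by
  rcases h.2.2 with h | h
  · exact h.2.ge
  · exact h.2

theorem moveAlong_dem_le {t : V} (h : 0 ≤ σ.dem t) (e : SArc A b) (t' : V) :
    (moveAlong D b σ t e).dem t' ≤ σ.dem t' := by
  cases e with
  | inl a => exact le_rfl
  | inr s =>
    simp only [UnsplitTrans.moveAlong, Function.update_apply]
    split_ifs with h1
    · rw [h1]; exact h
    · exact le_rfl

theorem moveAlong_dem_pos {t : V} {e : SArc A b} {t' : V}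
    (h : 0 < (moveAlong D b σ t e).dem t') :
    (moveAlong D b σ t e).dem t' = σ.dem t' ∧
      (t' ≠ t → (moveAlong D b σ t e).pos t' = σ.pos t') ∧
      (t' = t → stail D b e = some ((moveAlong D b σ t e).pos t')) := by
  cases e with
  | inl a =>
    refine ⟨rfl, fun h1 => ?_, fun h1 => ?_⟩
    · simp [UnsplitTrans.moveAlong, h1]
    · subst h1; simp [UnsplitTrans.moveAlong, stail]
  | inr s =>
    have h1 : t' ≠ t := by
      rintro rfl
      simp [UnsplitTrans.moveAlong] at h
    simp [UnsplitTrans.moveAlong, h1]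

theorem moveAlong_y_le {t : V} (h : 0 ≤ σ.dem t) (e e' : SArc A b) :
    (moveAlong D b σ t e).y e' ≤ σ.y e' := by
  rw [moveAlong_y, Function.update_apply]
  split_ifs with h1
  · rw [h1]; linarith
  · exact le_rfl

variable [Fintype V] [Fintype A]

/-- The invariant of the move phase. -/
structure MoveInv (D : Net V A) (x : A → ℝ) (S : Set (SArc A b)) (σ : State V A b) : Prop where
  core : Core D x σ
  closed : ClosedArcs D b σ.y S
  regular : Regular D S ∅ σ
  pairs : PairsOK σ
  load : ∀ M, DemandBound b M → ∀ a, LoadOK x S σ M a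

/-- The invariant of the search phase. -/
structure SearchInv (D : Net V A) (x : A → ℝ) (σ : State V A b) : Prop where
  core : Core D x σ
  lt : ∀ t e e', 0 < σ.dem t → shead D b e = σ.pos t → 0 < σ.y e' →
    stail D b e' = some (σ.pos t) → σ.y e < σ.dem t
  unique : ∀ t₁ t₂ e₁ e₂, 0 < σ.dem t₁ → 0 < σ.dem t₂ → σ.pos t₁ = σ.pos t₂ →
    shead D b e₁ = σ.pos t₁ → shead D b e₂ = σ.pos t₂ →
    σ.dem t₁ ≤ σ.y e₁ → σ.dem t₂ ≤ σ.y e₂ → t₁ = t₂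
  ne : ∀ t e, 0 < σ.dem t → shead D b e = σ.pos t → σ.y e ≠ σ.dem t
  pairs : PairsOK σ
  load : ∀ M, DemandBound b M → ∀ a, LoadOK x (singular D b σ.y) σ M a
  active : ∃ t, 0 < σ.dem t

variable {x : A → ℝ}

/-- The two moving rules serve `Regular` and `LoadOK`: a labeled arc vanishes when it is used, and
an unlabeled arc can end only at the tail of unlabeled arcs. -/
theorem MoveInv.move (h : MoveInv D x S σ) {t : V} {e : SArc A b} (hm : CanMove D b S σ t e) :
    MoveInv D x S (moveAlong D b σ t e) := by
  have ht := hm.1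
  have hle := hm.dem_le
  have hye : 0 < σ.y e := ht.trans_le hle
  have hmono := moveAlong_y_le (D := D) ht.le e
  have hsupp : ∀ e', 0 < (moveAlong D b σ t e).y e' → 0 < σ.y e' :=
    fun e' he' => he'.trans_le (hmono e')
  have hcore := h.core.moveAlong ht hm.2.1 hle
  refine ⟨hcore, h.closed.mono hsupp, ⟨?_, ?_⟩, ⟨?_, ?_⟩, ?_⟩
  · intro t' e₁ e₂ hd _ h1 hS hp h2
    obtain ⟨hd1, hd2, hd3⟩ := moveAlong_dem_pos hd
    rw [hd1] at hd ⊢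
    by_cases htt : t' = t
    · have htail := hd3 htt
      -- If an arc of `S` entering the token's new vertex carried more than the demand, closedness
      -- would put `e` into `S` as the only arc leaving that vertex. The move would then have
      -- emptied it, leaving no outgoing arc `e₂`.
      by_contra hcon
      have hy1 : 0 < σ.y e₁ := hsupp e₁ (hd.trans (not_le.1 hcon))
      obtain ⟨hf, hout⟩ := h.closed e₁ hS hy1
      rw [h1] at hf hout
      have he : e ∈ S := hout ⟨hye, htail⟩
      have he2 : e₂ = e := hf ⟨hsupp _ hp, h2⟩ ⟨hye, htail⟩
      rcases hm.2.2 with h3 | h3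
      · rw [he2, moveAlong_y, Function.update_self, h3.2] at hp
        linarith
      · exact h3.1 he
    · rw [hd2 htt] at h1 h2
      exact (hmono e₁).trans (h.regular.le t' e₁ e₂ hd (by simp) h1 hS (hsupp _ hp) h2)
  · intro t₁ t₂ e₁ e₂ hd₁ hd₂ _ hpos h1 h2 hS₁ hS₂ hlt₁ hlt₂
    obtain ⟨ha1, ha2, ha3⟩ := moveAlong_dem_pos hd₁
    obtain ⟨hb1, hb2, hb3⟩ := moveAlong_dem_pos hd₂
    rw [ha1] at hd₁ hlt₁
    rw [hb1] at hd₂ hlt₂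
    by_contra hne
    -- If one of the two tokens has just arrived along `e`, then `e` left the vertex of the other
    -- one beforehand, so `regular.le` already made that other token large.
    by_cases htt : t₁ = t
    · have htt₂ : t₂ ≠ t := fun h' => hne (htt.trans h'.symm)
      have h3 := ha3 htt
      rw [hpos, hb2 htt₂] at h3
      rw [hb2 htt₂] at h2
      have := h.regular.le t₂ e₂ e hd₂ (by simp) h2 hS₂ hye h3
      linarith [hmono e₂]
    · by_cases htt₂ : t₂ = t
      · have h3 := hb3 htt₂
        rw [← hpos, ha2 htt] at h3
        rw [ha2 htt] at h1
        have := h.regular.le t₁ e₁ e hd₁ (by simp) h1 hS₁ hye h3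
        linarith [hmono e₁]
      · rw [ha2 htt] at hpos h1
        rw [hb2 htt₂] at hpos h2
        exact hne (h.regular.unique t₁ t₂ e₁ e₂ hd₁ hd₂ (by simp) hpos h1 h2 hS₁ hS₂
          (hlt₁.trans_le (hmono _)) (hlt₂.trans_le (hmono _)))
  · cases e with
    | inl a => exact h.pairs.nodup
    | inr s =>
      simp only [UnsplitTrans.moveAlong, List.map_cons, List.nodup_cons]
      refine ⟨fun hmem => ?_, h.pairs.nodup⟩
      obtain ⟨p, hp, hpe⟩ := List.mem_map.1 hmem
      rw [Prod.mk.injEq] at hpe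
      rcases h.pairs.done p hp with h1 | h1
      · rw [hpe.2] at h1; exact ht.ne' h1
      · exact hye.ne' (h1 s hpe.1.symm)
  · have key : ∀ p ∈ σ.routed, (moveAlong D b σ t e).dem p.sink = 0 ∨
        ∀ s : {s // 0 < b s}, s.1 = p.source → (moveAlong D b σ t e).y (.inr s) = 0 := by
      intro p hp
      rcases h.pairs.done p hp with h1 | h1
      · left
        exact le_antisymm ((moveAlong_dem_le ht.le e _).trans h1.le) (hcore.dem_nonneg _)
      · right
        intro s hs
        exact le_antisymm ((hmono _).trans (h1 s hs).le) (hcore.nonneg _)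
    cases e with
    | inl a => exact key
    | inr s =>
      intro p hp
      simp only [UnsplitTrans.moveAlong, List.mem_cons] at hp
      rcases hp with rfl | hp
      · left; simp [UnsplitTrans.moveAlong]
      · exact key p hp
  · intro M hM a
    have hl := load_moveAlong_le (D := D) ht.le e a
    have hdM : σ.dem t ≤ M := (h.core.dem_le t).trans (hM t)
    have hy : (moveAlong D b σ t e).y (.inl a) =
        σ.y (.inl a) - if e = .inl a then σ.dem t else 0 := by
      rw [moveAlong_y, Function.update_apply]
      by_cases h1 : e = .inl a
      · simp [h1]
      · simp [h1, Ne.symm h1]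
    unfold LoadOK
    rw [hy]
    by_cases h1 : e = .inl a
    · simp only [h1, if_true] at hl ⊢
      rcases h.load M hM a with h2 | ⟨h2, h3⟩ | ⟨h2, -⟩
      · left; linarith
      · right; right
        -- The flow on this labeled arc may have been raised above `x`, but the token takes all of
        -- it: the load grows by one demand and the arc disappears.
        rcases hm.2.2 with h4 | h4
        · rw [← h1]
          exact ⟨by linarith [h4.2], by rw [h1]; linarith⟩
        · rw [h1] at h4; exact absurd h2 h4.1
      · rw [h1] at hye; linarith
    · simp only [h1, if_false] at hl ⊢
      rcases h.load M hM a with h2 | ⟨h2, h3⟩ | ⟨h2, h3⟩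
      · left; linarith
      · right; left; exact ⟨h2, by linarith⟩
      · right; right; exact ⟨by linarith, by linarith⟩

/-- With no move available, an incoming flow that is at least a token's demand must lie on a labeled
arc and be strictly larger. This sharpens `Regular` into strict inequalities in which labels no
longer occur. -/
theorem MoveInv.search (h : MoveInv D x S σ) (hactive : ∃ t, 0 < σ.dem t)
    (hstuck : ∀ t e, ¬ CanMove D b S σ t e) : SearchInv D x σ := by
  have hns : ∀ t e, 0 < σ.dem t → shead D b e = σ.pos t → σ.dem t ≤ σ.y e →
      e ∈ S ∧ σ.dem t < σ.y e := by
    intro t e hd he hle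
    have := hstuck t e
    simp only [CanMove, hd, he, true_and, not_or, not_and] at this
    by_cases hS : e ∈ S
    · exact ⟨hS, lt_of_le_of_ne hle (Ne.symm (this.1 hS))⟩
    · exact absurd hle (this.2 hS)
  refine ⟨h.core, ?_, ?_, ?_, h.pairs, ?_, hactive⟩
  · intro t e e' hd he hp he'
    by_contra hcon
    obtain ⟨h1, h2⟩ := hns t e hd he (not_lt.1 hcon)
    exact absurd (h.regular.le t e e' hd (by simp) he h1 hp he') (not_le.2 h2)
  · intro t₁ t₂ e₁ e₂ hd₁ hd₂ hpos h1 h2 hle₁ hle₂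
    obtain ⟨h3, h4⟩ := hns t₁ e₁ hd₁ h1 hle₁
    obtain ⟨h5, h6⟩ := hns t₂ e₂ hd₂ h2 hle₂
    exact h.regular.unique t₁ t₂ e₁ e₂ hd₁ hd₂ (by simp) hpos h1 h2 h3 h5 h4 h6
  · intro t e hd he heq
    exact absurd heq (hns t e hd he heq.ge).2.ne'
  · intro M hM a
    rcases h.load M hM a with h1 | ⟨h1, h2⟩ | h1
    · exact .inl h1
    · rcases (h.core.nonneg (.inl a)).eq_or_lt with h3 | h3
      · left; rw [← h3]; linarith
      · exact .inr (.inl ⟨h.closed.subset_singular h1 h3, h2⟩)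
    · exact .inr (.inr h1)

/-- A junction vertex has a token whose demand exceeds the flow on a given incoming arc. -/
theorem SearchInv.exists_token (h : SearchInv D x σ) {a' : SArc A b} (hpos : 0 < σ.y a')
    (hj : outArcs D b σ.y (some (shead D b a')) = ∅) :
    ∃ t, σ.pos t = shead D b a' ∧ σ.y a' < σ.dem t := by
  by_contra hcon
  push Not at hcon
  have h1 := h.core.cons (shead D b a')
  rw [net_eq, outflow_eq_zero h.core.nonneg hj, sub_zero] at h1
  have h2 := le_inflow h.core.nonneg (rfl : shead D b a' = shead D b a')
  rw [h1] at h2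
  obtain ⟨t, -, ht⟩ := Finset.exists_lt_of_sum_lt (s := Finset.univ) (f := fun _ : V => (0 : ℝ))
    (g := fun t => if σ.pos t = shead D b a' then σ.dem t else 0)
    (by simp only [Finset.sum_const_zero]; exact hpos.trans_le h2)
  split_ifs at ht with h3
  · have h4 : demandAt σ.pos σ.dem (shead D b a') = σ.dem t := by
      unfold demandAt
      rw [Finset.sum_eq_single t]
      · simp [h3]
      · intro t' _ hne
        split_ifs with h5
        · by_contra h6
          have h7 : 0 < σ.dem t' := lt_of_le_of_ne (h.core.dem_nonneg t') (Ne.symm h6)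
          exact hne (h.unique t' t a' a' h7 ht (h5.trans h3.symm) h5.symm h3.symm
            (hcon t' h5) (hcon t h3))
        · rfl
      · simp
    -- The flow on `a'` is at most the inflow, hence at most this single demand, so the two are
    -- equal. Then the token could have been moved.
    exact h.ne t a' ht h3.symm (le_antisymm (h4 ▸ h2) (hcon t h3))
  · exact lt_irrefl _ ht

/-- The flow on a singular arc is at most the demand of some token. -/
theorem SearchInv.exists_le_dem (h : SearchInv D x σ) {r : V → ℕ} (hr : Ranked D x r) {N : ℕ}
    (hN : ∀ v, r v ≤ N) {e : SArc A b} (he : e ∈ singular D b σ.y) (hpos : 0 < σ.y e) :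
    ∃ t, σ.y e ≤ σ.dem t := by
  induction hk : N - r (shead D b e) using Nat.strong_induction_on generalizing e with
  | _ k ih =>
    by_cases hout : outArcs D b σ.y (some (shead D b e)) = ∅
    · obtain ⟨t, -, ht⟩ := h.exists_token hpos hout
      exact ⟨t, ht.le⟩
    · obtain ⟨e', he'⟩ := Set.nonempty_iff_ne_empty.2 hout
      -- A token at a vertex that has an outgoing arc exceeds every incoming flow. If there is none,
      -- the inflow leaves on the single outgoing arc, which is again singular and has a head of
      -- larger rank.
      by_cases htok : ∃ t, σ.pos t = shead D b e ∧ 0 < σ.dem t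
      · obtain ⟨t, h1, h2⟩ := htok
        exact ⟨t, (h.lt t e e' h2 h1.symm he'.1 (by rw [h1]; exact he'.2)).le⟩
      · obtain ⟨hf, hsub⟩ := closedArcs_singular σ.y e he hpos
        have h1 := h.core.cons (shead D b e)
        have h2 : demandAt σ.pos σ.dem (shead D b e) = 0 := by
          refine Finset.sum_eq_zero fun t _ => ?_
          split_ifs with h3
          · by_contra h4
            exact htok ⟨t, h3, lt_of_le_of_ne (h.core.dem_nonneg t) (Ne.symm h4)⟩
          · rfl
        rw [net_eq, outflow_eq_of_funnel h.core.nonneg hf he'.2 he'.1, h2] at h1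
        have h3 := le_inflow h.core.nonneg (rfl : shead D b e = shead D b e)
        have h4 : r (shead D b e) < r (shead D b e') := by
          cases e' with
          | inl a =>
            have := hr a (h.core.supp a he'.1)
            rw [← Option.some.inj he'.2]
            exact this
          | inr s => exact absurd he'.2 (by simp [stail])
        have h5 := hN (shead D b e')
        obtain ⟨t, ht⟩ := ih _ (by omega) (hsub he') he'.1 rfl
        exact ⟨t, by linarith⟩

theorem moveInv_initial (hx : IsTransshipment D b x) :
    MoveInv D x ∅ (initial b x).state := by
  have hx' := (isTransshipment_iff.1 hx).2
  refine ⟨?_, fun e he => absurd he (by simp), ⟨by simp, by simp⟩, ⟨by simp [initial], by simp [initial]⟩, ?_⟩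
  · exact {
      nonneg := by
        rintro (a | s)
        · exact hx.1 a
        · exact s.2.le
      supp := fun a ha => ha
      dem_nonneg := fun t => le_max_right _ _
      dem_le := fun t => le_rfl
      cons := by
        intro v
        have h1 := hx' v
        have h4 : demandAt (id : V → V) (fun t => max (-b t) 0) v = max (-b v) 0 := by
          simp [demandAt]
        refine Eq.trans ?_ h4.symm
        simp only [net, Fintype.sum_sum_type, initial, Sum.elim_inl, Sum.elim_inr, incidence_inl,
          incidence_inr]
        have h2 : ∑ a, x a * ((if D.head a = v then 1 else 0) - (if D.tail a = v then 1 else 0)) =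
            - b v := by
          rw [← h1, ← Finset.sum_neg_distrib]
          exact Finset.sum_congr rfl fun a _ => by ring
        have h3 : ∑ s : {s : V // 0 < b s}, b s.1 * (if s.1 = v then 1 else 0) = max (b v) 0 := by
          by_cases hv : 0 < b v
          · rw [Finset.sum_eq_single ⟨v, hv⟩]
            · simp [hv.le]
            · intro s _ hs
              have : s.1 ≠ v := fun h' => hs (Subtype.ext h')
              simp [this]
            · simp
          · rw [max_eq_right (not_lt.1 hv)]
            refine Finset.sum_eq_zero fun s _ => ?_
            have : s.1 ≠ v := by rintro rfl; exact hv s.2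
            simp [this]
        rw [h2, h3]
        rcases le_total (b v) 0 with hv | hv
        · rw [max_eq_right hv, max_eq_left (by linarith)]; ring
        · rw [max_eq_left hv, max_eq_right (by linarith)]; ring
      trail_walk := fun t => rfl
      trail_supp := by simp [initial]
      src := by simp [initial]
      snk := by simp [initial]
      source_pos := by simp [initial]
      sink_neg := by simp [initial]
      amount_pos := by simp [initial]
      walk := by simp [initial]
      arcs_supp := by simp [initial] }
  · intro M _ a
    left
    simp [load, totalFlow, trailLoad, initial]

end Invariants

/-! ### Alternating walks -/

section AlternatingWalks

variable {V : Type u} {A : Type v} {D : Net V A} {b : V → ℝ}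

/-- The vertex at which the traversal of an arc starts. -/
def startpt (D : Net V A) (b : V → ℝ) : SArc A b × Dir → Option V
  | (e, .fwd) => stail D b e
  | (e, .bwd) => some (shead D b e)

/-- Walks that are built by admissible continuations, most recent arc first. -/
inductive AltWalk (D : Net V A) (b : V → ℝ) (y : SArc A b → ℝ) (u : Option V) :
    List (SArc A b × Dir) → Prop
  | nil : AltWalk D b y u []
  | cons {W : List (SArc A b × Dir)} {p : SArc A b × Dir} (h : AltWalk D b y u W)
      (hp : Extends D b y u W p) : AltWalk D b y u (p :: W)

variable {y : SArc A b → ℝ} {u : Option V} {W : List (SArc A b × Dir)} {p : SArc A b × Dir}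

theorem Extends.startpt_eq (h : Extends D b y u W p) : startpt D b p = curr D b u W := by
  cases h with
  | start he => exact he.2
  | fwd_fwd he => exact he.2
  | fwd_bwd _ _ _ _ hhead _ _ => exact congrArg some hhead
  | bwd_bwd hw _ _ _ hhead _ _ => exact (congrArg some hhead).trans hw.symm
  | bwd_fwd hw _ he _ => exact he.2.trans hw.symm

theorem Extends.pos (h : Extends D b y u W p) : 0 < y p.1 := by
  cases h with
  | start he => exact he.1
  | fwd_fwd he => exact he.1
  | fwd_bwd _ hpos _ _ _ _ _ => exact hpos
  | bwd_bwd _ _ hpos _ _ _ _ => exact hpos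
  | bwd_fwd _ _ he _ => exact he.1

theorem Extends.endpt_ne_none (h : Extends D b y u W p) : endpt D b p ≠ none := by
  cases h with
  | start he => simp [endpt]
  | fwd_fwd he => simp [endpt]
  | fwd_bwd _ _ _ _ _ htail _ => simp [endpt, htail]
  | bwd_bwd _ _ _ _ _ htail _ => simp [endpt, htail]
  | bwd_fwd _ _ he _ => simp [endpt]

theorem Extends.bwd {e : SArc A b} (h : Extends D b y u W (e, .bwd)) :
    e ∈ singular D b y ∧ ∃ w, stail D b e = some w ∧ LeadsToNonFunnel D b y w := by
  cases h with
  | fwd_bwd _ _ _ hs _ htail hl => exact ⟨hs, _, htail, hl⟩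
  | bwd_bwd _ _ _ hs _ htail hl => exact ⟨hs, _, htail, hl⟩

/-- The walk never turns back on the arc just used: at both kinds of turning point a different arc
is required. -/
theorem Extends.dir_eq {q : SArc A b × Dir} (h : Extends D b y u (q :: W) p) (hpq : p.1 = q.1) :
    p.2 = q.2 := by
  cases h with
  | fwd_fwd he => rfl
  | fwd_bwd _ _ hne _ _ _ _ => exact absurd hpq hne
  | bwd_bwd _ _ _ _ _ _ _ => rfl
  | bwd_fwd _ _ _ hne => exact absurd hpq hne

theorem AltWalk.of_append {C W' : List (SArc A b × Dir)} (h : AltWalk D b y u (C ++ W')) :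
    ∀ p ∈ C, ∃ W, Extends D b y u W p := by
  induction C with
  | nil => simp
  | cons q C ih =>
    cases h with
    | cons h hp => exact List.forall_mem_cons.2 ⟨⟨_, hp⟩, ih h⟩

theorem visited_append (C W' : List (SArc A b × Dir)) :
    visited D b u (C ++ W') = C.map (endpt D b) ++ visited D b u W' := by
  induction C with
  | nil => rfl
  | cons q C ih => simp [visited, ih]

theorem curr_mem_visited (W : List (SArc A b × Dir)) : curr D b u W ∈ visited D b u W := by
  cases W <;> simp [curr, visited]

theorem exists_append_of_mem_visited {z : Option V} (h : z ∈ visited D b u W) :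
    ∃ C W', W = C ++ W' ∧ curr D b u W' = z := by
  induction W with
  | nil => exact ⟨[], [], rfl, (List.mem_singleton.1 h).symm⟩
  | cons q W ih =>
    rcases List.mem_cons.1 h with h | h
    · exact ⟨[], q :: W, rfl, h.symm⟩
    · obtain ⟨C, W', rfl, hW'⟩ := ih h
      exact ⟨q :: C, W', rfl, hW'⟩

theorem length_visited (W : List (SArc A b × Dir)) :
    (visited D b u W).length = W.length + 1 := by
  induction W with
  | nil => rfl
  | cons q W ih => simp [visited, ih]

theorem AltWalk.sum_sub {C W' : List (SArc A b × Dir)} (h : AltWalk D b y u (C ++ W'))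
    (f : Option V → ℝ) : (C.map fun p => f (endpt D b p) - f (startpt D b p)).sum =
      f (curr D b u (C ++ W')) - f (curr D b u W') := by
  induction C with
  | nil => simp
  | cons q C ih =>
    cases h with
    | cons h hp =>
      rw [List.map_cons, List.sum_cons, ih h, hp.startpt_eq]
      simp [curr]

theorem sum_pulse_of_mem {ι E : Type*} {L : List ι} {arc : ι → E} (hL : (L.map arc).Nodup)
    (w : ι → ℝ) {p : ι} (hp : p ∈ L) :
    (L.map fun q => if arc q = arc p then w q else 0).sum = w p := by
  induction L with
  | nil => simp at hp
  | cons q L ih =>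
    rw [List.map_cons, List.nodup_cons] at hL
    rw [List.map_cons, List.sum_cons]
    rcases List.mem_cons.1 hp with rfl | hp
    · rw [if_pos rfl, List.sum_eq_zero, add_zero]
      simp only [List.mem_map]
      rintro _ ⟨q', hq', rfl⟩
      rw [if_neg]
      intro h
      exact hL.1 (h ▸ List.mem_map_of_mem hq')
    · rw [ih hL.2 hp, if_neg, zero_add]
      intro h
      exact hL.1 (h ▸ List.mem_map_of_mem hp)

theorem sum_pulse_of_notMem {ι E : Type*} {L : List ι} {arc : ι → E} (w : ι → ℝ) {e : E}
    (he : e ∉ L.map arc) : (L.map fun q => if arc q = e then w q else 0).sum = 0 := by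
  rw [List.sum_eq_zero]
  simp only [List.mem_map]
  rintro _ ⟨q', hq', rfl⟩
  rw [if_neg]
  rintro rfl
  exact he (List.mem_map_of_mem hq')

/-- `C` is an alternating cycle at the end of an admissible walk. -/
structure AltCycle (D : Net V A) (b : V → ℝ) (y : SArc A b → ℝ) (u : Option V)
    (C W' : List (SArc A b × Dir)) : Prop where
  walk : AltWalk D b y u (C ++ W')
  ne_nil : C ≠ []
  closed : curr D b u W' = curr D b u (C ++ W')
  nodup : (C.map (endpt D b)).Nodup

theorem AltWalk.altCycle {C W' : List (SArc A b × Dir)} (h : AltWalk D b y u W)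
    (hv : (visited D b u W).Nodup) (hp : Extends D b y u W p) (hC : p :: W = C ++ W')
    (hne : C ≠ []) (hrevisit : curr D b u W' = endpt D b p) : AltCycle D b y u C W' := by
  cases C with
  | nil => exact absurd rfl hne
  | cons q C =>
    obtain ⟨rfl, rfl⟩ := List.cons.inj hC
    refine ⟨.cons h hp, hne, hrevisit, ?_⟩
    change (visited D b u (C ++ W')).Nodup at hv
    rw [visited_append] at hv
    rw [List.map_cons, List.nodup_cons, ← hrevisit]
    refine ⟨fun hm => ?_, (List.nodup_append.1 hv).1⟩
    exact (List.nodup_append.1 hv).2.2 _ hm _ (curr_mem_visited W') rfl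

theorem startpt_eq_endpt {p q : SArc A b × Dir} (h1 : p.1 = q.1) (h2 : p.2 ≠ q.2) :
    startpt D b p = endpt D b q := by
  obtain ⟨e, d⟩ := p
  obtain ⟨e', d'⟩ := q
  cases h1
  cases d <;> cases d'
  · exact absurd rfl h2
  · rfl
  · rfl
  · exact absurd rfl h2

/-- Reversing an arc `q` means starting where `q` ended. As endpoints are distinct, `q` would be the
immediately preceding step, which the walk cannot reverse. -/
theorem AltWalk.dir_unique {C W' : List (SArc A b × Dir)} (h : AltWalk D b y u (C ++ W'))
    (hn : (C.map (endpt D b)).Nodup) : ∀ p ∈ C, ∀ q ∈ C, p.1 = q.1 → p.2 = q.2 := by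
  induction C with
  | nil => simp
  | cons c C ih =>
    cases h with
    | cons h hp =>
      rw [List.map_cons, List.nodup_cons] at hn
      have ih := ih h hn.2
      have key : ∀ q ∈ C, c.1 = q.1 → c.2 = q.2 := by
        intro q hq hcq
        by_contra hne
        have h1 : curr D b u (C ++ W') = endpt D b q :=
          hp.startpt_eq.symm.trans (startpt_eq_endpt hcq hne)
        cases C with
        | nil => simp at hq
        | cons q' C =>
          have h2 : q' = q := List.inj_on_of_nodup_map hn.2 List.mem_cons_self hq h1
          subst h2
          exact hne (hp.dir_eq hcq)
      intro p hpC q hqC hpq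
      rcases List.mem_cons.1 hpC with rfl | hpC'
      · rcases List.mem_cons.1 hqC with rfl | hqC'
        · rfl
        · exact key q hqC' hpq
      · rcases List.mem_cons.1 hqC with rfl | hqC'
        · exact (key p hpC' hpq.symm).symm
        · exact ih p hpC' q hqC' hpq

variable {C W' : List (SArc A b × Dir)}

theorem AltCycle.dir_unique (h : AltCycle D b y u C W') :
    ∀ p ∈ C, ∀ q ∈ C, p.1 = q.1 → p.2 = q.2 := h.walk.dir_unique h.nodup

theorem AltCycle.nodup_arcs (h : AltCycle D b y u C W') : (C.map Prod.fst).Nodup :=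
  h.nodup.of_map.map_on fun p hp q hq hpq => Prod.ext hpq (h.dir_unique p hp q hq hpq)

theorem AltCycle.pos (h : AltCycle D b y u C W') : ∀ p ∈ C, 0 < y p.1 := fun p hp =>
  (h.walk.of_append p hp).choose_spec.pos

theorem AltCycle.exists_endpt_eq (h : AltCycle D b y u C W') :
    ∀ p ∈ C, ∃ q ∈ C, endpt D b q = startpt D b p := by
  have key : ∀ C, AltWalk D b y u (C ++ W') → ∀ p ∈ C,
      startpt D b p = curr D b u W' ∨ ∃ q ∈ C, endpt D b q = startpt D b p := by
    intro C hC
    induction C with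
    | nil => simp
    | cons c C ih =>
      cases hC with
      | cons hC hp =>
        intro p hpC
        rcases List.mem_cons.1 hpC with rfl | hpC
        · rw [hp.startpt_eq]
          cases C with
          | nil => exact .inl rfl
          | cons q C => exact .inr ⟨q, by simp, rfl⟩
        · rcases ih hC p hpC with h1 | ⟨q, hq, h1⟩
          · exact .inl h1
          · exact .inr ⟨q, List.mem_cons_of_mem _ hq, h1⟩
  intro p hp
  rcases key C h.walk p hp with h1 | h1
  · rw [h1, h.closed]
    cases hC : C with
    | nil => exact absurd hC h.ne_nil
    | cons q C => exact ⟨q, List.mem_cons_self, rfl⟩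
  · exact h1

/-- No step ends at the super-source, and on a cycle every step starts where some step ends.
Augmentations therefore leave the dummy arcs unchanged. -/
theorem AltCycle.inr_notMem (h : AltCycle D b y u C W') (s : {s : V // 0 < b s}) (d : Dir) :
    ((.inr s, d) : SArc A b × Dir) ∉ C := by
  intro hm
  have hne : ∀ q ∈ C, endpt D b q ≠ none := fun q hq =>
    (h.walk.of_append q hq).choose_spec.endpt_ne_none
  cases d with
  | fwd =>
    obtain ⟨q, hq, h1⟩ := h.exists_endpt_eq _ hm
    exact hne q hq h1
  | bwd => exact hne _ hm rfl

theorem AltCycle.sum_eq_zero (h : AltCycle D b y u C W') (f : Option V → ℝ) :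
    (C.map fun p => f (endpt D b p) - f (startpt D b p)).sum = 0 := by
  rw [h.walk.sum_sub, h.closed, sub_self]

/-- Backward steps strictly decrease the rank, so they cannot close a cycle by themselves. This
ensures that the minimum defining the augmentation is over a nonempty set. -/
theorem AltCycle.exists_fwd (h : AltCycle D b y u C W') {x : A → ℝ} {r : V → ℕ}
    (hr : Ranked D x r) (hx : ∀ a, 0 < y (.inl a) → 0 < x a) : ∃ e, (e, Dir.fwd) ∈ C := by
  by_contra hcon
  push Not at hcon
  let f : Option V → ℝ := fun z => z.elim 0 fun v => (r v : ℝ)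
  have h1 := h.sum_eq_zero f
  have h2 : ∀ p ∈ C, f (endpt D b p) - f (startpt D b p) ≤ -1 := by
    rintro ⟨e, d⟩ hp
    cases d with
    | fwd => exact absurd hp (hcon e)
    | bwd =>
      cases e with
      | inr s => exact absurd hp (h.inr_notMem s _)
      | inl a =>
        have := hr a (hx a (h.pos _ hp))
        have : (r (D.tail a) : ℝ) + 1 ≤ r (D.head a) := by exact_mod_cast this
        simp only [f, endpt, startpt, stail, shead, Option.elim]
        linarith
  have h3 := List.sum_le_card_nsmul (C.map fun p => f (endpt D b p) - f (startpt D b p)) (-1)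
    (by
      intro z hz
      obtain ⟨p, hp, rfl⟩ := List.mem_map.1 hz
      exact h2 p hp)
  rw [h1, List.length_map, nsmul_eq_mul] at h3
  have h4 : (0 : ℝ) < C.length := by exact_mod_cast List.length_pos_iff.2 h.ne_nil
  linarith

theorem singular_of_outArcs_eq_empty {y : SArc A b → ℝ} {e : SArc A b}
    (h : outArcs D b y (some (shead D b e)) = ∅) : e ∈ singular D b y := by
  intro w hw
  rcases Relation.ReflTransGen.cases_head hw with rfl | ⟨w', ⟨e', h1, h2, -⟩, -⟩
  · exact fun a ha => absurd (h ▸ ha : a ∈ (∅ : Set (SArc A b))) (by simp)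
  · exact absurd (h ▸ (⟨h1, h2⟩ : e' ∈ outArcs D b y (some (shead D b e))) :
      e' ∈ (∅ : Set (SArc A b))) (by simp)

end AlternatingWalks

/-! ### Augmentation along an alternating cycle -/

section Augment

variable {V : Type u} {A : Type v} {D : Net V A} {b : V → ℝ}
  {σ : State V A b} {u : Option V} {C W' : List (SArc A b × Dir)} {x : A → ℝ} {ε : ℝ}

theorem AltCycle.augment_y_fwd {e : SArc A b} (he : (e, Dir.fwd) ∈ C) :
    (augment σ C ε).y e = σ.y e - ε := by
  simp [augment, he]

theorem AltCycle.augment_y_bwd (h : AltCycle D b σ.y u C W') {e : SArc A b}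
    (he : (e, Dir.bwd) ∈ C) : (augment σ C ε).y e = σ.y e + ε := by
  have : (e, Dir.fwd) ∉ C := fun hf => by
    have := h.dir_unique _ he _ hf rfl
    cases this
  simp [augment, he, this]

theorem AltCycle.augment_y_of_notMem {e : SArc A b} (he : ∀ d, (e, d) ∉ C) :
    (augment σ C ε).y e = σ.y e := by
  simp [augment, he]

theorem augmentValues_fwd (hε : IsLeast (augmentValues D b σ C) ε) {e : SArc A b}
    (he : (e, Dir.fwd) ∈ C) : ε ≤ σ.y e := hε.2 (.inl ⟨e, he, rfl⟩)

theorem augmentValues_bwd (hε : IsLeast (augmentValues D b σ C) ε) {e : SArc A b} {t : V}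
    (he : (e, Dir.bwd) ∈ C) (ht : 0 < σ.dem t) (hp : shead D b e = σ.pos t)
    (hlt : σ.y e < σ.dem t) : σ.y e + ε ≤ σ.dem t := by
  have := hε.2 (.inr ⟨e, t, he, ht, hp.symm, hlt, rfl⟩)
  linarith

theorem AltCycle.ε_pos (h : AltCycle D b σ.y u C W') (hε : IsLeast (augmentValues D b σ C) ε) :
    0 < ε := by
  rcases hε.1 with ⟨e, he, rfl⟩ | ⟨e, t, -, -, -, hlt, rfl⟩
  · exact h.pos _ he
  · linarith

theorem AltCycle.cases_arc (C : List (SArc A b × Dir)) (e : SArc A b) :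
    (e, Dir.fwd) ∈ C ∨ (e, Dir.bwd) ∈ C ∨ ∀ d, (e, d) ∉ C := by
  by_cases h1 : (e, Dir.fwd) ∈ C
  · exact .inl h1
  · by_cases h2 : (e, Dir.bwd) ∈ C
    · exact .inr (.inl h2)
    · exact .inr (.inr fun d => by cases d; exacts [h1, h2])

theorem AltCycle.augment_supp (h : AltCycle D b σ.y u C W') {e : SArc A b} (he : 0 < (augment σ C ε).y e) :
    0 < σ.y e := by
  rcases cases_arc C e with h1 | h1 | h1
  · exact h.pos _ h1
  · exact h.pos _ h1
  · rwa [augment_y_of_notMem h1] at he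

/-- Augmentation keeps the flow on an arc below the demand of a token at its head. -/
theorem AltCycle.augment_le (h : AltCycle D b σ.y u C W')
    (hε : IsLeast (augmentValues D b σ C) ε) {e : SArc A b} {t : V} (ht : 0 < σ.dem t)
    (hp : shead D b e = σ.pos t) (hlt : σ.y e < σ.dem t) : (augment σ C ε).y e ≤ σ.dem t := by
  rcases cases_arc C e with h1 | h1 | h1
  · rw [augment_y_fwd h1]; linarith [h.ε_pos hε]
  · rw [h.augment_y_bwd h1]; exact augmentValues_bwd hε h1 ht hp hlt
  · rw [augment_y_of_notMem h1]; exact hlt.le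

/-- After an augmentation either an arc vanishes or a token can be moved. -/
theorem AltCycle.progress (h : AltCycle D b σ.y u C W')
    (hε : IsLeast (augmentValues D b σ C) ε) :
    (∃ e, 0 < σ.y e ∧ (UnsplitTrans.augment σ C ε).y e = 0) ∨
      ∃ t e, CanMove D b (singular D b σ.y) (UnsplitTrans.augment σ C ε) t e := by
  rcases hε.1 with ⟨e, he, h1⟩ | ⟨e, t, he, ht, hp, hlt, h1⟩
  · left
    exact ⟨e, h.pos _ he, by rw [augment_y_fwd he]; linarith⟩
  · right
    refine ⟨t, e, ht, hp.symm, .inl ⟨(h.walk.of_append _ he).choose_spec.bwd.1, ?_⟩⟩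
    rw [h.augment_y_bwd he]
    change _ = σ.dem t
    linarith

variable [Fintype V] [Fintype A]

/-- Each step shifts the same amount, negated at its endpoint and restored at its starting point,
whichever its direction; around the cycle this telescopes to zero. -/
theorem AltCycle.net_augment (h : AltCycle D b σ.y u C W') (v : V) :
    net D b (augment σ C ε).y v = net D b σ.y v := by
  let w : SArc A b × Dir → ℝ := fun p => match p.2 with
    | .fwd => -ε
    | .bwd => ε
  rw [net_add_pulse C Prod.fst w (y := σ.y)]
  · rw [add_eq_left]
    have h1 := h.sum_eq_zero fun z => if z = some v then -ε else 0
    rw [← h1]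
    refine congrArg _ (List.map_congr_left fun p _ => ?_)
    obtain ⟨e, d⟩ := p
    cases d with
    | fwd =>
      by_cases h2 : shead D b e = v <;> by_cases h3 : stail D b e = some v <;>
        simp [w, endpt, startpt, incidence, h2, h3]
    | bwd =>
      by_cases h2 : shead D b e = v <;> by_cases h3 : stail D b e = some v <;>
        simp [w, endpt, startpt, incidence, h2, h3]
  · intro e
    by_cases he : e ∈ C.map Prod.fst
    · obtain ⟨⟨e, d⟩, hp, rfl⟩ := List.mem_map.1 he
      have h1 := sum_pulse_of_mem h.nodup_arcs w hp
      have h2 : (C.map fun q => if q.1 = e then w q else 0).sum = w (e, d) := by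
        convert h1
      rw [h2]
      cases d with
      | fwd => rw [augment_y_fwd hp]; simp only [w]; ring
      | bwd => rw [h.augment_y_bwd hp]
    · have h2 : (C.map fun q => if q.1 = e then w q else 0).sum = 0 := by
        convert sum_pulse_of_notMem w he
      rw [h2, add_zero, augment_y_of_notMem]
      exact fun d hd => he (List.mem_map_of_mem hd)

/-- An arc whose flow was below a token's demand never overshoots it, by the choice of `ε`, so `lt`
and `unique` weaken exactly to `Regular`. For the load, backward arcs are singular, and forgetting
their flow leaves a load of at most `x`. -/
theorem SearchInv.augment (hσ : SearchInv D x σ) (h : AltCycle D b σ.y u C W')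
    (hε : IsLeast (augmentValues D b σ C) ε) :
    MoveInv D x (singular D b σ.y) (augment σ C ε) := by
  have hεpos := h.ε_pos hε
  have hsupp : ∀ e, 0 < (UnsplitTrans.augment σ C ε).y e → 0 < σ.y e := fun e => h.augment_supp
  have hinr : ∀ s, (UnsplitTrans.augment σ C ε).y (.inr s) = σ.y (.inr s) := fun s =>
    AltCycle.augment_y_of_notMem fun d => h.inr_notMem s d
  have hcore : Core D x (UnsplitTrans.augment σ C ε) := by
    refine hσ.core.of_flow (fun e => ?_) (fun a => hsupp _) h.net_augment hinr
    change 0 ≤ (UnsplitTrans.augment σ C ε).y e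
    rcases AltCycle.cases_arc C e with h1 | h1 | h1
    · rw [AltCycle.augment_y_fwd h1]; linarith [augmentValues_fwd hε h1]
    · rw [h.augment_y_bwd h1]; linarith [hσ.core.nonneg e]
    · rw [AltCycle.augment_y_of_notMem h1]; exact hσ.core.nonneg e
  refine ⟨hcore, (closedArcs_singular σ.y).mono hsupp, ⟨?_, ?_⟩, ⟨hσ.pairs.nodup, ?_⟩, ?_⟩
  · intro t e e' hd _ he _ hp he'
    exact h.augment_le hε hd he (hσ.lt t e e' hd he (hsupp _ hp) he')
  · intro t₁ t₂ e₁ e₂ hd₁ hd₂ _ hpos h1 h2 _ _ hlt₁ hlt₂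
    refine hσ.unique t₁ t₂ e₁ e₂ hd₁ hd₂ hpos h1 h2 ?_ ?_
    · by_contra hcon
      exact absurd (h.augment_le hε hd₁ h1 (not_le.1 hcon)) (not_le.2 hlt₁)
    · by_contra hcon
      exact absurd (h.augment_le hε hd₂ h2 (not_le.1 hcon)) (not_le.2 hlt₂)
  · intro p hp
    rcases hσ.pairs.done p hp with h1 | h1
    · exact .inl h1
    · exact .inr fun s hs => (hinr s).trans (h1 s hs)
  · intro M hM a
    have hload : UnsplitTrans.load (UnsplitTrans.augment σ C ε) a = UnsplitTrans.load σ a := rfl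
    unfold LoadOK
    rw [hload]
    have h0 := hσ.core.nonneg (.inl a)
    rcases hσ.load M hM a with h2 | h2 | h2
    · rcases AltCycle.cases_arc C (.inl a) with h1 | h1 | h1
      · left; rw [AltCycle.augment_y_fwd h1]; linarith
      · right; left
        exact ⟨(h.walk.of_append _ h1).choose_spec.bwd.1, by linarith⟩
      · left; rw [AltCycle.augment_y_of_notMem h1]; exact h2
    · exact .inr (.inl h2)
    · right; right
      refine ⟨?_, h2.2⟩
      rw [AltCycle.augment_y_of_notMem, h2.1]
      intro d hd
      have := h.pos _ hd
      exact this.ne' h2.1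

theorem AltCycle.exists_isLeast (h : AltCycle D b σ.y u C W') {r : V → ℕ}
    (hr : Ranked D x r) (hx : ∀ a, 0 < σ.y (.inl a) → 0 < x a) :
    ∃ ε, IsLeast (augmentValues D b σ C) ε := by
  have hfin : (augmentValues D b σ C).Finite := by
    refine ((Set.finite_range σ.y).union
      (Set.finite_range fun q : SArc A b × V => σ.dem q.2 - σ.y q.1)).subset ?_
    rintro z (⟨e, -, rfl⟩ | ⟨e, t, -, -, -, -, rfl⟩)
    · exact .inl ⟨e, rfl⟩
    · exact .inr ⟨(e, t), rfl⟩
  obtain ⟨e, he⟩ := h.exists_fwd hr hx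
  obtain ⟨ε, h1, h2⟩ := Set.exists_min_image _ id hfin ⟨_, .inl ⟨e, he, rfl⟩⟩
  exact ⟨ε, h1, h2⟩

end Augment

/-! ### The search for an alternating cycle never gets stuck -/

section Search

variable {V : Type u} {A : Type v} {D : Net V A} {b : V → ℝ} [Fintype V] [Fintype A]
  {σ : State V A b} {u : Option V} {W : List (SArc A b × Dir)} {x : A → ℝ}

theorem SearchInv.exists_step (hσ : SearchInv D x σ) {r : V → ℕ} (hr : Ranked D x r)
    (hW : AltWalk D b σ.y u W) (hv : (visited D b u W).Nodup)
    (hu : (outArcs D b σ.y u).Nonempty) : ∃ κ, Step D b ⟨.search u W, σ⟩ κ := by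
  by_cases hext : ∃ p, Extends D b σ.y u W p
  · obtain ⟨p, hp⟩ := hext
    by_cases hnew : endpt D b p ∈ visited D b u W
    · obtain ⟨C, W', hCW, hW'⟩ := exists_append_of_mem_visited hnew
      have hC : p :: W = (p :: C) ++ W' := by rw [hCW]; rfl
      have hcyc := hW.altCycle hv hp hC (List.cons_ne_nil _ _) hW'
      obtain ⟨ε, hε⟩ := hcyc.exists_isLeast hr hσ.core.supp
      exact ⟨_, .close hp hC (List.cons_ne_nil _ _) hW' hε⟩
    · exact ⟨_, .extend hp hnew⟩
  · push Not at hext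
    cases hW with
    | nil =>
      obtain ⟨e, he⟩ := hu
      exact absurd (.start he) (hext _)
    | @cons W p h hp =>
      obtain ⟨f, d⟩ := p
      cases d with
      | fwd =>
        by_cases hout : outArcs D b σ.y (some (shead D b f)) = ∅
        · obtain ⟨t, ht, hdem⟩ := hσ.exists_token hp.pos hout
          refine ⟨_, .singularDigraph hout ?_ ht hdem⟩
          intro e u' hpos hne hhead htail hl
          refine hext _ (.fwd_bwd hout hpos hne ?_ hhead htail hl)
          exact singular_of_outArcs_eq_empty (by rw [hhead]; exact hout)
        · obtain ⟨e, he⟩ := Set.nonempty_iff_ne_empty.2 hout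
          exact absurd (.fwd_fwd he) (hext _)
      | bwd =>
        obtain ⟨-, w, hw, hl⟩ := hp.bwd
        -- Backward arcs are taken only towards a vertex that leads to a non-funnel vertex. The
        -- witness of this either names the next backward arc or shows that the turn forward has
        -- been reached.
        by_cases hf : Funnel D b σ.y w
        · cases hl with
          | here h' => exact absurd hf h'
          | back hu hpos hs hhead htail hl =>
            exact absurd (.bwd_bwd hw hf hpos hs hhead htail hl) (hext _)
        · have : ∃ e ∈ outArcs D b σ.y (some w), e ≠ f := by
            by_contra hcon
            push Not at hcon
            exact hf fun a ha c hc => (hcon a ha).trans (hcon c hc).symm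
          obtain ⟨e, he, hne⟩ := this
          exact absurd (.bwd_fwd hw hf he hne) (hext _)

end Search

/-! ### Routing in a singular digraph -/

section Route

variable {V : Type u} {A : Type v} {D : Net V A} {b : V → ℝ}

theorem dem_eq_zero_of_residual_eq_zero {R : Set V} {t : V} {a' : SArc A b}
    {σ : State V A b} (hdone : ∀ t', σ.pos t' ∈ R → residual σ t a' t' = 0) {t' : V} (ht' : t' ≠ t)
    (hR : σ.pos t' ∈ R) : σ.dem t' = 0 := by
  have := hdone t' hR
  simpa only [residual, ht', if_false] using this

theorem IsWalk.mem_of_head_mem {R : Set V} {u w : V} {l : List A} (hl : IsWalk D u l w) (hu : u ∈ R)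
    (h : ∀ a ∈ l, D.head a ∈ R) : w ∈ R := by
  induction l generalizing u with
  | nil => cases hl; exact hu
  | cons a l ih =>
    exact ih hl.2 (h a List.mem_cons_self) fun c hc => h c (List.mem_cons_of_mem _ hc)

theorem sendBack_amount_pos {σ : State V A b} {T : Set (SArc A b)} {t t' : V}
    {a' : SArc A b} {s : {s : V // 0 < b s}} {l : List A} {ε : ℝ} (hres : 0 < residual σ t a' t')
    (hT : ∀ e ∈ starPath s l, e ∈ T ∧ 0 < σ.y e)
    (hε : IsLeast ({residual σ t a' t'} ∪ σ.y '' starPath s l) ε) : 0 < ε := by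
  rcases hε.1 with h1 | ⟨e, he, rfl⟩
  · rw [h1]; exact hres
  · exact (hT e he).2

variable [Fintype V]

theorem LoadOK.mono {x : A → ℝ} {S : Set (SArc A b)} {σ σ' : State V A b} {M : ℝ} {a : A} (h : LoadOK x S σ M a)
    (hl : load σ' a ≤ load σ a) (hy : σ'.y (.inl a) = σ.y (.inl a)) : LoadOK x S σ' M a := by
  unfold LoadOK
  rw [hy]
  rcases h with h | h | h
  · exact .inl (by linarith)
  · exact .inr (.inl ⟨h.1, by linarith⟩)
  · exact .inr (.inr ⟨h.1, by linarith⟩)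

theorem le_demandAt {pos : V → V} {dem : V → ℝ} (hd : ∀ t, 0 ≤ dem t) (t : V) :
    dem t ≤ demandAt pos dem (pos t) := by
  have := Finset.single_le_sum (f := fun t' => if pos t' = pos t then dem t' else 0)
    (fun i _ => by split_ifs; exacts [hd i, le_rfl]) (Finset.mem_univ t)
  simp only [if_true] at this
  exact this

theorem add_le_demandAt {pos : V → V} {dem : V → ℝ} (hd : ∀ t, 0 ≤ dem t) {t t' : V}
    (hne : t ≠ t') (hpos : pos t' = pos t) : dem t + dem t' ≤ demandAt pos dem (pos t) := by
  have := Finset.sum_le_sum_of_subset_of_nonneg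
    (f := fun t' => if pos t' = pos t then dem t' else 0) (Finset.subset_univ {t, t'})
    (fun i _ _ => by split_ifs; exacts [hd i, le_rfl])
  rw [Finset.sum_pair hne] at this
  simp only [hpos, if_true] at this
  exact this

theorem demandAt_nonneg {pos : V → V} {dem : V → ℝ} (hd : ∀ t, 0 ≤ dem t) (v : V) :
    0 ≤ demandAt pos dem v :=
  Finset.sum_nonneg fun i _ => by split_ifs; exacts [hd i, le_rfl]

variable [Fintype A]

/-- The invariant of the route phase. -/
structure RouteInv (D : Net V A) (x : A → ℝ) (S T : Set (SArc A b)) (R : Set V) (t : V)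
    (a' : SArc A b) (σ : State V A b) : Prop where
  core : Core D x σ
  closed : ClosedArcs D b σ.y S
  regular : Regular D S R σ
  mem : a' ∈ S
  pos : 0 < σ.y a'
  notMem : a' ∉ T
  pos_eq : σ.pos t = shead D b a'
  head_mem' : shead D b a' ∈ R
  le_dem : σ.y a' ≤ σ.dem t
  head_mem : ∀ e ∈ T, shead D b e ∈ R
  tail_mem : ∀ e ∈ T, ∀ u, stail D b e = some u → u ∈ R
  enter : ∀ e, 0 < σ.y e → shead D b e ∈ R → e ≠ a' → e ∈ T
  leave : ∀ e u, 0 < σ.y e → stail D b e = some u → u ∈ R → e ∈ T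
  det : ∀ a₁ a₂, .inl a₁ ∈ T → .inl a₂ ∈ T → D.tail a₁ = D.tail a₂ → a₁ = a₂
  nodup : (σ.routed.map fun p => (p.source, p.sink)).Nodup
  done : ∀ p ∈ σ.routed, σ.dem p.sink = 0 ∨ ∀ s : {s // 0 < b s}, s.1 = p.source →
    σ.y (.inr s) = 0 ∨ (.inr s ∈ T ∧ (residual σ t a' p.sink = 0 ∨
      ∀ l, IsPath D s.1 l (σ.pos p.sink) → (∀ a ∈ l, .inl a ∈ T) → ∃ e ∈ starPath s l, σ.y e = 0))
  load_mem : ∀ M, DemandBound b M → ∀ a, .inl a ∈ T → load σ a + σ.y (.inl a) ≤ x a + M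
  load_notMem : ∀ M, DemandBound b M → ∀ a, .inl a ∉ T → LoadOK x S σ M a

variable {x : A → ℝ} {S T : Set (SArc A b)} {R : Set V} {t : V} {a' : SArc A b} {σ : State V A b}
  {r : V → ℕ}

/-- Since the backward search meets only funnel vertices, the explored part is closed under leaving
arcs and, apart from `a'`, under entering arcs. Routing can therefore be analysed inside it alone.
-/
theorem SearchInv.route (hσ : SearchInv D x σ) (hr : Ranked D x r) {N : ℕ} (hN : ∀ v, r v ≤ N)
    (ha' : 0 < σ.y a') (hj : outArcs D b σ.y (some (shead D b a')) = ∅)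
    (hnone : ∀ e u', 0 < σ.y e → e ≠ a' → shead D b e = shead D b a' → stail D b e = some u' →
      ¬ LeadsToNonFunnel D b σ.y u')
    (hpos : σ.pos t = shead D b a') (hdem : σ.y a' < σ.dem t) :
    RouteInv D x (singular D b σ.y)
      {e | 0 < σ.y e ∧ e ≠ a' ∧ BackReach D b σ.y (shead D b a') a' (shead D b e)}
      {w | BackReach D b σ.y (shead D b a') a' w} t a' σ := by
  have hnone' : ∀ e, e ∉ outArcs D b σ.y (some (shead D b a')) := fun e he => by
    rw [hj] at he; exact he
  -- If an explored vertex led to a non-funnel vertex, so would the vertex from which it was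
  -- explored, back to an arc entering the root, where `hnone` forbids it.
  have hlead : ∀ u, BackReach D b σ.y (shead D b a') a' u →
      u = shead D b a' ∨ ¬ LeadsToNonFunnel D b σ.y u := by
    intro u hu
    induction hu with
    | root => exact .inl rfl
    | @back u u' e _ hp hne hs hhead htail ih =>
      right
      rcases ih with rfl | ih
      · exact hnone e u' hp hne hhead htail
      · intro hl
        refine ih (.back ?_ hp hs hhead htail hl)
        by_contra hf
        exact ih (.here hf)
  have hfun : ∀ u, BackReach D b σ.y (shead D b a') a' u → Funnel D b σ.y u := by
    intro u hu
    rcases hlead u hu with rfl | h1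
    · exact fun e he => absurd he (hnone' e)
    · by_contra hf
      exact h1 (.here hf)
  -- The root has no outgoing arc, and any other explored vertex has only the arc through which it
  -- was found.
  have hleave : ∀ e u, 0 < σ.y e → stail D b e = some u →
      BackReach D b σ.y (shead D b a') a' u →
      e ≠ a' ∧ BackReach D b σ.y (shead D b a') a' (shead D b e) := by
    intro e u hp htail hu
    have hf := hfun u hu
    cases hu with
    | root => exact absurd ⟨hp, htail⟩ (hnone' e)
    | back h hp' hne hs hhead htail' =>
      have := hf ⟨hp, htail⟩ ⟨hp', htail'⟩
      subst this
      exact ⟨hne, by rw [hhead]; exact h⟩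
  have hsing : ∀ e, BackReach D b σ.y (shead D b a') a' (shead D b e) →
      e ∈ singular D b σ.y := by
    intro e he w hw
    apply hfun
    induction hw with
    | refl => exact he
    | tail _ h1 ih =>
      obtain ⟨e', h2, h3, rfl⟩ := h1
      exact (hleave e' _ h2 h3 ih).2
  have htail : ∀ e u, 0 < σ.y e → e ≠ a' → BackReach D b σ.y (shead D b a') a' (shead D b e) →
      stail D b e = some u → BackReach D b σ.y (shead D b a') a' u := fun e u h1 h2 h3 h4 =>
    .back h3 h1 h2 (hsing e h3) rfl h4
  refine ⟨hσ.core, closedArcs_singular _, ⟨?_, ?_⟩, singular_of_outArcs_eq_empty hj, ha',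
    fun h => h.2.1 rfl, hpos, .root, hdem.le, fun e he => he.2.2, ?_, ?_, ?_, ?_, hσ.pairs.nodup,
    ?_, ?_, ?_⟩
  · exact fun t e e' hd _ he _ hp he' => (hσ.lt t e e' hd he hp he').le
  · exact fun t₁ t₂ e₁ e₂ hd₁ hd₂ _ hpos h1 h2 _ _ hlt₁ hlt₂ =>
      hσ.unique t₁ t₂ e₁ e₂ hd₁ hd₂ hpos h1 h2 hlt₁.le hlt₂.le
  · exact fun e he u hu => htail e u he.1 he.2.1 he.2.2 hu
  · exact fun e hp he hne => ⟨hp, hne, he⟩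
  · exact fun e u hp hu hR => ⟨hp, hleave e u hp hu hR⟩
  · intro a₁ a₂ h1 h2 heq
    have := hfun _ (htail _ _ h1.1 h1.2.1 h1.2.2 rfl) ⟨h1.1, rfl⟩ ⟨h2.1, congrArg some heq.symm⟩
    exact Sum.inl_injective this
  · intro p hp
    rcases hσ.pairs.done p hp with h1 | h1
    · exact .inl h1
    · exact .inr fun s hs => .inl (h1 s hs)
  · intro M hM a ha
    -- Here the remaining flow, and not only the load, must be bounded: it is at most one demand, so
    -- load plus flow is at most `x a + M` in every case of `LoadOK`.
    obtain ⟨t', ht'⟩ := hσ.exists_le_dem hr hN (hsing _ ha.2.2) ha.1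
    have := (hσ.core.dem_le t').trans (hM t')
    rcases hσ.load M hM a with h1 | h1 | h1
    · linarith [hσ.core.nonneg (.inl a)]
    · linarith
    · linarith
  · exact fun M hM a _ => hσ.load M hM a

/-- Conservation at `v`: the inflow covers the outflow and the demands. At the head of `a'`, the
token `t` reserves the flow on `a'`, so any further need must be supplied by another arc. -/
theorem RouteInv.exists_enter (h : RouteInv D x S T R t a' σ) {v : V} (hv : v ∈ R)
    (hneed : 0 < outflow D b σ.y v ∨ ∃ t', σ.pos t' = v ∧ 0 < residual σ t a' t') :
    ∃ e ∈ T, shead D b e = v ∧ 0 < σ.y e := by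
  have hcons := h.core.cons v
  rw [net_eq] at hcons
  have hout := outflow_nonneg (D := D) h.core.nonneg v
  by_cases hva : shead D b a' = v
  · have hlt : σ.y a' < inflow D b σ.y v := by
      have h1 := le_demandAt (pos := σ.pos) h.core.dem_nonneg t
      rw [h.pos_eq, hva] at h1
      have h2 := h.le_dem
      rcases hneed with h3 | ⟨t', h3, h4⟩
      · linarith
      · by_cases h5 : t' = t
        · subst h5
          simp only [residual, if_true] at h4
          linarith
        · simp only [residual, h5, if_false] at h4
          have h6 := add_le_demandAt (pos := σ.pos) h.core.dem_nonneg (Ne.symm h5)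
            (by rw [h3, h.pos_eq, hva])
          rw [h.pos_eq, hva] at h6
          linarith
    obtain ⟨e, h1, h2, h3⟩ := exists_ne_of_lt_inflow hva hlt
    exact ⟨e, h.enter e h3 (h2 ▸ hv) h1, h2, h3⟩
  · have hlt : 0 < inflow D b σ.y v := by
      have h1 := demandAt_nonneg (pos := σ.pos) h.core.dem_nonneg v
      rcases hneed with h3 | ⟨t', h3, h4⟩
      · linarith
      · have h5 : t' ≠ t := by
          rintro rfl
          exact hva (h.pos_eq.symm.trans h3)
        simp only [residual, h5, if_false] at h4
        have h6 := le_demandAt (pos := σ.pos) h.core.dem_nonneg t'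
        rw [h3] at h6
        linarith
    obtain ⟨e, h1, h2⟩ := exists_of_inflow_pos hlt
    exact ⟨e, h.enter e h2 (h1 ▸ hv) (by rintro rfl; exact hva h1), h1, h2⟩

/-- An entering arc of `T` creates outflow at its tail, which again lies in `R`. Going back lowers
the rank until a dummy arc is met. -/
theorem RouteInv.exists_path (h : RouteInv D x S T R t a' σ) (hr : Ranked D x r) {v : V}
    (hv : v ∈ R)
    (hneed : 0 < outflow D b σ.y v ∨ ∃ t', σ.pos t' = v ∧ 0 < residual σ t a' t') :
    ∃ (s : {s : V // 0 < b s}) (l : List A), IsPath D s.1 l v ∧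
      ∀ e ∈ starPath s l, e ∈ T ∧ 0 < σ.y e := by
  induction hk : r v using Nat.strong_induction_on generalizing v with
  | _ k ih =>
    obtain ⟨e, heT, hev, hpos⟩ := h.exists_enter hv hneed
    cases e with
    | inr s =>
      refine ⟨s, [], ?_, ?_⟩
      · cases hev
        exact ⟨rfl, by simp⟩
      · rintro e (rfl | ⟨a, ha, -⟩)
        · exact ⟨heT, hpos⟩
        · simp at ha
    | inl a =>
      have hlt := hr a (h.core.supp a hpos)
      have hev' : D.head a = v := hev
      obtain ⟨s, l, hl, hT⟩ := ih (r (D.tail a)) (by rw [← hk, ← hev']; exact hlt)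
        (h.tail_mem _ heT _ rfl) (.inl (hpos.trans_le (le_outflow h.core.nonneg rfl))) rfl
      have hT' : ∀ e ∈ starPath s (l ++ [a]), e ∈ T ∧ 0 < σ.y e := by
        rintro e (rfl | ⟨c, hc, rfl⟩)
        · exact hT _ (.inl rfl)
        · rcases List.mem_append.1 hc with hc | hc
          · exact hT _ (.inr ⟨c, hc, rfl⟩)
          · rw [List.mem_singleton.1 hc]; exact ⟨heT, hpos⟩
      refine ⟨s, l ++ [a], (hl.1.append (show IsWalk D (D.tail a) [a] v from ⟨rfl, hev'⟩)).isPath hr fun c hc => ?_, hT'⟩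
      exact h.core.supp c (hT' _ (.inr ⟨c, hc, rfl⟩)).2

theorem RouteInv.residual_nonneg (h : RouteInv D x S T R t a' σ) (t' : V) :
    0 ≤ residual σ t a' t' := by
  unfold residual
  split_ifs with h1
  · rw [h1]; linarith [h.le_dem]
  · exact h.core.dem_nonneg t'

theorem RouteInv.exists_step (h : RouteInv D x S T R t a' σ) (hr : Ranked D x r) :
    ∃ κ, Step D b ⟨.route S T R t a', σ⟩ κ := by
  by_cases hdone : ∀ t', σ.pos t' ∈ R → residual σ t a' t' = 0
  · exact ⟨_, .finishRoute hdone⟩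
  · push Not at hdone
    obtain ⟨t', ht', hne⟩ := hdone
    have hres := lt_of_le_of_ne (h.residual_nonneg t') (Ne.symm hne)
    obtain ⟨s, l, hl, hT⟩ := h.exists_path hr ht' (.inr ⟨t', rfl, hres⟩)
    have hfin : ({residual σ t a' t'} ∪ σ.y '' starPath s l : Set ℝ).Finite :=
      (Set.finite_singleton _).union ((Set.toFinite _).image _)
    obtain ⟨ε, h1, h2⟩ := Set.exists_min_image _ id hfin ⟨_, .inl rfl⟩
    exact ⟨_, .sendBack hres hl hT ⟨h1, h2⟩⟩

/-! ### Removing one path from the singular digraph -/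

section SendBack

variable {t' : V} {s : {s : V // 0 < b s}} {l : List A} {ε : ℝ}

theorem RouteInv.residual_le (h : RouteInv D x S T R t a' σ) (t' : V) :
    residual σ t a' t' ≤ σ.dem t' := by
  unfold residual
  split_ifs
  · linarith [h.pos]
  · exact le_rfl

theorem RouteInv.residual_sendBack (h : RouteInv D x S T R t a' σ)
    (hT : ∀ e ∈ starPath s l, e ∈ T ∧ 0 < σ.y e) (t'' : V) :
    residual (sendBack σ t' s l ε) t a' t'' =
      if t'' = t' then residual σ t a' t'' - ε else residual σ t a' t'' := by
  have h1 : (sendBack σ t' s l ε).y a' = σ.y a' := by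
    simp only [sendBack]
    rw [if_neg fun hm => h.notMem (hT _ hm).1]
  unfold residual
  rw [h1]
  by_cases h2 : t'' = t'
  · subst h2
    by_cases h3 : t'' = t <;> simp [sendBack, h3]
    ring
  · have h3 : (sendBack σ t' s l ε).dem t'' = σ.dem t'' := by simp [sendBack, h2]
    rw [h3, if_neg h2]

/-- What is sent passes from remaining flow to load, so their sum does not grow on `T`. The pair
just served is recorded in `done` either by an exhausted residual or by the emptied arc on its only
possible path. -/
theorem RouteInv.sendBack (h : RouteInv D x S T R t a' σ) (hr : Ranked D x r)
    (hres : 0 < residual σ t a' t') (hl : IsPath D s.1 l (σ.pos t'))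
    (hT : ∀ e ∈ starPath s l, e ∈ T ∧ 0 < σ.y e)
    (hε : IsLeast ({residual σ t a' t'} ∪ σ.y '' starPath s l) ε) :
    RouteInv D x S T R t a' (sendBack σ t' s l ε) := by
  have hε0 := sendBack_amount_pos hres hT hε
  have hεres : ε ≤ residual σ t a' t' := hε.2 (.inl rfl)
  have hεy : ∀ e ∈ starPath s l, ε ≤ σ.y e := fun e he => hε.2 (.inr ⟨e, he, rfl⟩)
  have hεd : ε ≤ σ.dem t' := hεres.trans (h.residual_le t')
  have hcore := h.core.sendBack hr hε0 hεd hl.1 hεy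
  have hmono : ∀ e, (UnsplitTrans.sendBack σ t' s l ε).y e ≤ σ.y e := by
    intro e
    simp only [UnsplitTrans.sendBack]
    split_ifs <;> linarith
  have hsupp : ∀ e, 0 < (UnsplitTrans.sendBack σ t' s l ε).y e → 0 < σ.y e :=
    fun e he => he.trans_le (hmono e)
  have hzero : ∀ e, σ.y e = 0 → (UnsplitTrans.sendBack σ t' s l ε).y e = 0 :=
    fun e he => le_antisymm ((hmono e).trans he.le) (hcore.nonneg e)
  have hy : ∀ e ∉ T, (UnsplitTrans.sendBack σ t' s l ε).y e = σ.y e := by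
    intro e he
    simp only [UnsplitTrans.sendBack]
    rw [if_neg fun hm => he (hT _ hm).1]
  have hposR : σ.pos t' ∈ R := hl.1.mem_of_head_mem (h.head_mem _ (hT (.inr s) (.inl rfl)).1)
    fun a ha => h.head_mem _ (hT (.inl a) (.inr ⟨a, ha, rfl⟩)).1
  have hdem : ∀ t'', t'' ≠ t' → (UnsplitTrans.sendBack σ t' s l ε).dem t'' = σ.dem t'' := by
    intro t'' hne
    simp [UnsplitTrans.sendBack, hne]
  have hres' := fun t'' => h.residual_sendBack (t' := t') (ε := ε) hT t''
  have hdone : ∀ p ∈ σ.routed, (UnsplitTrans.sendBack σ t' s l ε).dem p.sink = 0 ∨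
      ∀ s₁ : {s // 0 < b s}, s₁.1 = p.source →
        (UnsplitTrans.sendBack σ t' s l ε).y (.inr s₁) = 0 ∨ (.inr s₁ ∈ T ∧
        (residual (UnsplitTrans.sendBack σ t' s l ε) t a' p.sink = 0 ∨
          ∀ l', IsPath D s₁.1 l' (σ.pos p.sink) → (∀ a ∈ l', .inl a ∈ T) →
            ∃ e ∈ starPath s₁ l', (UnsplitTrans.sendBack σ t' s l ε).y e = 0)) := by
    intro p hp
    rcases h.done p hp with h1 | h1
    · left
      rw [hdem, h1]
      intro h2
      rw [h2] at h1
      linarith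
    · right
      intro s₁ hs₁
      rcases h1 s₁ hs₁ with h2 | ⟨h2, h3⟩
      · exact .inl (hzero _ h2)
      · refine .inr ⟨h2, ?_⟩
        rcases h3 with h3 | h3
        · left
          rw [hres', if_neg, h3]
          intro h4
          rw [h4] at h3
          linarith
        · right
          intro l' hl' hl'T
          obtain ⟨e, he, he0⟩ := h3 l' hl' hl'T
          exact ⟨e, he, hzero e he0⟩
  refine ⟨hcore, h.closed.mono hsupp, ⟨?_, ?_⟩, h.mem, ?_, h.notMem, h.pos_eq, h.head_mem', ?_,
    h.head_mem, h.tail_mem, fun e he => h.enter e (hsupp e he),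
    fun e u he => h.leave e u (hsupp e he), h.det, ?_, ?_, ?_, ?_⟩
  · intro t₁ e e' hd hR he hS hp he'
    have hne : t₁ ≠ t' := by rintro rfl; exact hR hposR
    rw [hdem t₁ hne] at hd ⊢
    exact (hmono e).trans (h.regular.le t₁ e e' hd hR he hS (hsupp _ hp) he')
  · intro t₁ t₂ e₁ e₂ hd₁ hd₂ hR hpos h1 h2 hS₁ hS₂ hlt₁ hlt₂
    have hne₁ : t₁ ≠ t' := by rintro rfl; exact hR hposR
    have hne₂ : t₂ ≠ t' := by
      rintro rfl
      apply hR
      rw [hpos]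
      exact hposR
    rw [hdem t₁ hne₁] at hd₁ hlt₁
    rw [hdem t₂ hne₂] at hd₂ hlt₂
    exact h.regular.unique t₁ t₂ e₁ e₂ hd₁ hd₂ hR hpos h1 h2 hS₁ hS₂
      (hlt₁.trans_le (hmono _)) (hlt₂.trans_le (hmono _))
  · rw [hy _ h.notMem]; exact h.pos
  · rw [hy _ h.notMem]
    by_cases h1 : t = t'
    · subst h1
      simp only [residual, if_true] at hεres
      simp only [UnsplitTrans.sendBack, Function.update_self]
      linarith
    · rw [hdem t h1]; exact h.le_dem
  · simp only [UnsplitTrans.sendBack, List.map_cons, List.nodup_cons]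
    refine ⟨fun hmem => ?_, h.nodup⟩
    obtain ⟨p, hp, hpe⟩ := List.mem_map.1 hmem
    rw [Prod.mk.injEq] at hpe
    have hpe2 : p.sink = t' := hpe.2
    rcases h.done p hp with h1 | h1
    · rw [hpe2] at h1; linarith
    -- A second path for the same pair would need a nonempty dummy arc, a positive residual and a
    -- path free of empty arcs; each alternative of `done` excludes one of these.
    · rcases h1 s hpe.1.symm with h2 | ⟨-, h2 | h2⟩
      · exact (hT _ (.inl rfl)).2.ne' h2
      · rw [hpe2] at h2; exact hres.ne' h2
      · obtain ⟨e, he, he0⟩ := h2 l (by rw [hpe2]; exact hl) fun a ha => (hT _ (.inr ⟨a, ha, rfl⟩)).1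
        exact (hT e he).2.ne' he0
  · intro p hp
    rcases List.mem_cons.1 hp with rfl | hp
    · right
      intro s₁ hs₁
      obtain rfl : s₁ = s := Subtype.ext hs₁
      refine .inr ⟨(hT _ (.inl rfl)).1, ?_⟩
      rcases hε.1 with h1 | ⟨e, he, h1⟩
      · left
        rw [hres', if_pos rfl]
        exact sub_eq_zero.2 h1.symm
      · right
        intro l' hl' hl'T
        -- Out-degrees within `T` are at most one, so any other path from `s` to this vertex is the
        -- path just used, and it contains the emptied arc `e`.
        obtain rfl : l = l' := hl.eq_of_deterministic hl' fun a ha c hc hac =>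
          h.det a c (hT _ (.inr ⟨a, ha, rfl⟩)).1 (hl'T c hc) hac
        refine ⟨e, he, ?_⟩
        simp only [UnsplitTrans.sendBack]
        rw [if_pos he, h1, sub_self]
    · exact hdone p hp
  · intro M hM a ha
    have h1 := load_sendBack_le (σ := σ) (t := t') (s := s) (l := l) hε0.le a
    have h2 := h.load_mem M hM a ha
    have h3 : (UnsplitTrans.sendBack σ t' s l ε).y (.inl a) =
        σ.y (.inl a) - if a ∈ l then ε else 0 := by
      have : (.inl a ∈ starPath s l) ↔ a ∈ l := by simp [starPath]
      simp only [UnsplitTrans.sendBack, this]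
      split_ifs <;> ring
    rw [h3]
    linarith
  · intro M hM a ha
    refine (h.load_notMem M hM a ha).mono ?_ (hy _ ha)
    have h1 := load_sendBack_le (σ := σ) (t := t') (s := s) (l := l) hε0.le a
    rwa [if_neg, add_zero] at h1
    exact fun hm => ha (hT _ (.inr ⟨a, hm, rfl⟩)).1

end SendBack

/-! ### End of the routing in a singular digraph -/

section Finish

theorem RouteInv.dem_eq (h : RouteInv D x S T R t a' σ)
    (hdone : ∀ t', σ.pos t' ∈ R → residual σ t a' t' = 0) : σ.dem t = σ.y a' := by
  have := hdone t (by rw [h.pos_eq]; exact h.head_mem')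
  simp only [residual, if_true] at this
  linarith

/-- When routing is complete, the only demand left in `R` is the part of `t` that matches the flow
on `a'`. Flow entering along `T` cannot be absorbed and must leave again, along an arc of `T`. -/
theorem RouteInv.exists_leave (h : RouteInv D x S T R t a' σ)
    (hdone : ∀ t', σ.pos t' ∈ R → residual σ t a' t' = 0) {e : SArc A b} (he : e ∈ T)
    (hpos : 0 < σ.y e) : ∃ e' ∈ T, 0 < σ.y e' ∧ stail D b e' = some (shead D b e) := by
  have hR := h.head_mem e he
  have hcons := h.core.cons (shead D b e)
  rw [net_eq] at hcons
  have hdem : ∀ v ∈ R, demandAt σ.pos σ.dem v = if shead D b a' = v then σ.y a' else 0 := by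
    intro v hv
    unfold demandAt
    rw [Finset.sum_eq_single t]
    · rw [h.pos_eq, h.dem_eq hdone]
    · intro t' _ hne
      split_ifs with h1
      · exact dem_eq_zero_of_residual_eq_zero hdone hne (h1 ▸ hv)
      · rfl
    · simp
  rw [hdem _ hR] at hcons
  have hout : 0 < outflow D b σ.y (shead D b e) := by
    split_ifs at hcons with h1
    · have := add_le_inflow (D := D) h.core.nonneg
        (show e ≠ a' from fun h2 => h.notMem (h2 ▸ he)) rfl h1
      linarith
    · have := le_inflow (D := D) h.core.nonneg (rfl : shead D b e = _)
      linarith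
  obtain ⟨e', h1, h2⟩ := exists_of_outflow_pos hout
  exact ⟨e', h.leave e' _ h2 h1 hR, h2, h1⟩

theorem RouteInv.y_eq_zero (h : RouteInv D x S T R t a' σ) (hr : Ranked D x r) {N : ℕ}
    (hN : ∀ v, r v ≤ N) (hdone : ∀ t', σ.pos t' ∈ R → residual σ t a' t' = 0) {e : SArc A b}
    (he : e ∈ T) : σ.y e = 0 := by
  by_contra hne
  have hpos := lt_of_le_of_ne (h.core.nonneg e) (Ne.symm hne)
  clear hne
  induction hk : N - r (shead D b e) using Nat.strong_induction_on generalizing e with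
  | _ k ih =>
    obtain ⟨e', h1, h2, h3⟩ := h.exists_leave hdone he hpos
    cases e' with
    | inr s => simp [stail] at h3
    | inl a =>
      have h4 := hr a (h.core.supp a h2)
      have h5 := hN (D.head a)
      have h6 : D.tail a = shead D b e := Option.some.inj h3
      refine ih (N - r (D.head a)) ?_ h1 h2 rfl
      rw [← hk, ← h6]
      omega

/-- Positive flow on `T` could be followed along arcs of `T` to ever larger ranks. So the digraph is
already empty, and the deletion changes nothing. -/
theorem RouteInv.removeArcs_eq (h : RouteInv D x S T R t a' σ) (hr : Ranked D x r) {N : ℕ}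
    (hN : ∀ v, r v ≤ N) (hdone : ∀ t', σ.pos t' ∈ R → residual σ t a' t' = 0) :
    removeArcs σ T = σ := by
  have : (fun e => if e ∈ T then 0 else σ.y e) = σ.y := by
    funext e
    split_ifs with he
    · exact (h.y_eq_zero hr hN hdone he).symm
    · rfl
  unfold removeArcs
  rw [this]

theorem RouteInv.canMove (h : RouteInv D x S T R t a' σ)
    (hdone : ∀ t', σ.pos t' ∈ R → residual σ t a' t' = 0) : CanMove D b S σ t a' :=
  ⟨h.pos.trans_le h.le_dem, h.pos_eq.symm, .inl ⟨h.mem, (h.dem_eq hdone).symm⟩⟩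

/-- The invariant holds just before the last move of the routing, which by `RouteInv.canMove` is an
ordinary move. In `R` only `t` is active and no outgoing flow is left, which gives `Regular`; the
emptied dummy arcs turn the relaxed `done` back into `PairsOK`. -/
theorem RouteInv.moveInv (h : RouteInv D x S T R t a' σ) (hr : Ranked D x r) {N : ℕ}
    (hN : ∀ v, r v ≤ N) (hdone : ∀ t', σ.pos t' ∈ R → residual σ t a' t' = 0) :
    MoveInv D x S σ := by
  have hz : ∀ e ∈ T, σ.y e = 0 := fun e he => h.y_eq_zero hr hN hdone he
  have ht : ∀ t', 0 < σ.dem t' → σ.pos t' ∈ R → t' = t := by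
    intro t' hd hR
    by_contra hne
    exact hd.ne' (dem_eq_zero_of_residual_eq_zero hdone hne hR)
  refine ⟨h.core, h.closed, ⟨?_, ?_⟩, ⟨h.nodup, ?_⟩, ?_⟩
  · intro t₁ e e' hd _ he hS hp he'
    by_cases hR : σ.pos t₁ ∈ R
    · exact absurd (hz _ (h.leave e' _ hp he' hR)) hp.ne'
    · exact h.regular.le t₁ e e' hd hR he hS hp he'
  · intro t₁ t₂ e₁ e₂ hd₁ hd₂ _ hpos h1 h2 hS₁ hS₂ hlt₁ hlt₂
    by_cases hR : σ.pos t₁ ∈ R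
    · rw [ht t₁ hd₁ hR, ht t₂ hd₂ (hpos ▸ hR)]
    · exact h.regular.unique t₁ t₂ e₁ e₂ hd₁ hd₂ hR hpos h1 h2 hS₁ hS₂ hlt₁ hlt₂
  · intro p hp
    rcases h.done p hp with h1 | h1
    · exact .inl h1
    · right
      intro s hs
      rcases h1 s hs with h2 | ⟨h2, -⟩
      · exact h2
      · exact hz _ h2
  · intro M hM a
    by_cases ha : .inl a ∈ T
    · right; right
      have := h.load_mem M hM a ha
      have h0 := hz _ ha
      exact ⟨h0, by linarith⟩
    · exact h.load_notMem M hM a ha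

end Finish

end Route

/-! ### Invariant and potential of an execution -/

section Execution

variable {V : Type u} {A : Type v} [Fintype V] {D : Net V A} {b : V → ℝ}

theorem length_le_of_nodup {u : Option V} {W : List (SArc A b × Dir)}
    (h : (visited D b u W).Nodup) : W.length ≤ Fintype.card V := by
  have := h.length_le_card
  rw [length_visited, Fintype.card_option] at this
  omega

variable [Fintype A]

/-- The invariant of the algorithm. -/
def ConfigInv (D : Net V A) (x : A → ℝ) : Config V A b → Prop
  | ⟨.move S, σ⟩ => MoveInv D x S σ
  | ⟨.search u W, σ⟩ => SearchInv D x σ ∧ AltWalk D b σ.y u W ∧ (visited D b u W).Nodup ∧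
      (outArcs D b σ.y u).Nonempty
  | ⟨.route S T R t a', σ⟩ => RouteInv D x S T R t a' σ

/-- Bound on the number of moves that the token of `t` can still make. -/
noncomputable def height (r : V → ℕ) (σ : State V A b) (t : V) : ℕ :=
  if 0 < σ.dem t then r (σ.pos t) + 1 else 0

/-- Bound on the number of moves and of deletions of arcs that are still possible. -/
noncomputable def remaining (r : V → ℕ) (σ : State V A b) : ℕ :=
  ∑ t, height r σ t + (Finset.univ.filter fun e => 0 < σ.y e).card

/-- Bound on the number of actions before the next move or deletion of an arc. -/
noncomputable def phaseTerm (D : Net V A) : Config V A b → ℕ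
  | ⟨.move S, σ⟩ => if ∃ t e, CanMove D b S σ t e then 0 else Fintype.card V + 5
  | ⟨.search _ W, _⟩ => Fintype.card V + 3 - W.length
  | ⟨.route _ _ _ t a', σ⟩ => if 0 < residual σ t a' t then 1 else 0

/-- Bound on the number of actions still to come. -/
noncomputable def potential (D : Net V A) (r : V → ℕ) (κ : Config V A b) : ℕ :=
  (Fintype.card V + 7) * remaining r κ.state + phaseTerm D κ

variable {x : A → ℝ} {r : V → ℕ} {σ σ' : State V A b}

theorem remaining_le (hh : ∀ t, height r σ' t ≤ height r σ t) (hy : ∀ e, 0 < σ'.y e → 0 < σ.y e) :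
    remaining r σ' ≤ remaining r σ := by
  refine add_le_add (Finset.sum_le_sum fun t _ => hh t) (Finset.card_le_card fun e he => ?_)
  simp only [Finset.mem_filter, Finset.mem_univ, true_and] at he ⊢
  exact hy e he

theorem remaining_lt_of_height (hh : ∀ t, height r σ' t ≤ height r σ t)
    (hy : ∀ e, 0 < σ'.y e → 0 < σ.y e) {t : V} (ht : height r σ' t < height r σ t) :
    remaining r σ' < remaining r σ := by
  refine add_lt_add_of_lt_of_le (Finset.sum_lt_sum (fun t _ => hh t) ⟨t, Finset.mem_univ t, ht⟩)
    (Finset.card_le_card fun e he => ?_)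
  simp only [Finset.mem_filter, Finset.mem_univ, true_and] at he ⊢
  exact hy e he

theorem remaining_lt_of_arc (hh : ∀ t, height r σ' t ≤ height r σ t)
    (hy : ∀ e, 0 < σ'.y e → 0 < σ.y e) {e : SArc A b} (he : 0 < σ.y e) (he' : σ'.y e = 0) :
    remaining r σ' < remaining r σ := by
  refine add_lt_add_of_le_of_lt (Finset.sum_le_sum fun t _ => hh t) (Finset.card_lt_card ?_)
  refine (Finset.ssubset_iff_of_subset fun e he => ?_).2 ⟨e, by simpa using he, by simp [he']⟩
  simp only [Finset.mem_filter, Finset.mem_univ, true_and] at he ⊢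
  exact hy e he

theorem remaining_moveAlong_lt (h : Core D x σ) (hr : Ranked D x r) {t : V} {e : SArc A b}
    (ht : 0 < σ.dem t) (he : shead D b e = σ.pos t) (hle : σ.dem t ≤ σ.y e) :
    remaining r (moveAlong D b σ t e) < remaining r σ := by
  have hy : ∀ e', 0 < (moveAlong D b σ t e).y e' → 0 < σ.y e' :=
    fun e' he' => he'.trans_le (moveAlong_y_le ht.le e e')
  have hlt : height r (moveAlong D b σ t e) t < height r σ t := by
    cases e with
    | inl a =>
      have := hr a (h.supp a (ht.trans_le hle))
      have he' : D.head a = σ.pos t := he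
      simpa [height, UnsplitTrans.moveAlong, ht, ← he'] using this
    | inr s => simp [height, UnsplitTrans.moveAlong, ht]
  refine remaining_lt_of_height (fun t' => ?_) hy hlt
  by_cases h1 : t' = t
  · rw [h1]; exact hlt.le
  · cases e with
    | inl a => simp [height, UnsplitTrans.moveAlong, h1]
    | inr s => simp [height, UnsplitTrans.moveAlong, h1]

/-- The weight `Fintype.card V + 7` exceeds the largest phase term, so one move or deletion pays for
any change of phase. -/
theorem potential_lt_of_remaining_lt {κ κ' : Config V A b}
    (h : remaining r κ'.state < remaining r κ.state)
    (hp : phaseTerm D κ' ≤ Fintype.card V + 5) : potential D r κ' < potential D r κ := by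
  unfold potential
  have := Nat.mul_le_mul_left (Fintype.card V + 7) (Nat.succ_le_of_lt h)
  rw [Nat.mul_succ] at this
  omega

theorem phaseTerm_move_le (S : Set (SArc A b)) (σ : State V A b) :
    phaseTerm D ⟨.move S, σ⟩ ≤ Fintype.card V + 5 := by
  simp only [phaseTerm]
  split_ifs <;> omega

theorem phaseTerm_route_le (S T : Set (SArc A b)) (R : Set V) (t : V) (a' : SArc A b)
    (σ : State V A b) : phaseTerm D ⟨.route S T R t a', σ⟩ ≤ 1 := by
  simp only [phaseTerm]
  split_ifs <;> omega

/-- Every action preserves the invariant and decreases the potential. -/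
theorem ConfigInv.step (hr : Ranked D x r) (hN : ∀ v, r v ≤ Fintype.card V) {κ κ' : Config V A b}
    (h : ConfigInv D x κ) (hs : Step D b κ κ') :
    ConfigInv D x κ' ∧ potential D r κ' < potential D r κ := by
  cases hs with
  | @move S σ t e hm =>
    change MoveInv D x S σ at h
    exact ⟨h.move hm, potential_lt_of_remaining_lt
      (remaining_moveAlong_lt h.core hr hm.1 hm.2.1 hm.dem_le) (phaseTerm_move_le _ _)⟩
  | @iterate S σ u hactive hstuck hu =>
    change MoveInv D x S σ at h
    refine ⟨⟨h.search hactive hstuck, .nil, by simp [visited], hu⟩, ?_⟩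
    have : ¬ ∃ t e, CanMove D b S σ t e := fun ⟨t, e, hm⟩ => hstuck t e hm
    simp only [potential, phaseTerm, this, if_false, List.length_nil]
    omega
  | @extend u W σ p hp hnew =>
    obtain ⟨h1, h2, h3, h4⟩ := h
    refine ⟨⟨h1, .cons h2 hp, List.nodup_cons.2 ⟨hnew, h3⟩, h4⟩, ?_⟩
    have := length_le_of_nodup h3
    simp only [potential, phaseTerm, List.length_cons]
    omega
  | @close u W σ p C W' ε hp hC hne hrevisit hε =>
    obtain ⟨h1, h2, h3, h4⟩ := h
    have hcyc := h2.altCycle h3 hp hC hne hrevisit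
    refine ⟨h1.augment hcyc hε, ?_⟩
    have hsupp : ∀ e, 0 < (augment σ C ε).y e → 0 < σ.y e := fun e => hcyc.augment_supp
    have hh : ∀ t, height r (augment σ C ε) t ≤ height r σ t := fun t => le_rfl
    -- Either an arc was deleted, or a token can now move. In the second case the phase term drops
    -- to 0, whereas during the search it is at least 3.
    rcases hcyc.progress hε with ⟨e, he, he'⟩ | hmove
    · exact potential_lt_of_remaining_lt (remaining_lt_of_arc hh hsupp he he')
        (phaseTerm_move_le _ _)
    · have h5 := Nat.mul_le_mul_left (Fintype.card V + 7) (remaining_le hh hsupp)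
      have h6 := length_le_of_nodup h3
      simp only [potential, phaseTerm, hmove, if_true]
      omega
  | @singularDigraph u W σ a' t hjunction hnone hpos hdem =>
    obtain ⟨h1, h2, h3, h4⟩ := h
    cases h2 with
    | cons h2 hp =>
      refine ⟨h1.route hr hN hp.pos hjunction hnone hpos hdem, ?_⟩
      have h5 := phaseTerm_route_le (D := D) (singular D b σ.y)
        {e | 0 < σ.y e ∧ e ≠ a' ∧ BackReach D b σ.y (shead D b a') a' (shead D b e)}
        {w | BackReach D b σ.y (shead D b a') a' w} t a' σ
      have h6 := length_le_of_nodup h3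
      rw [List.length_cons] at h6
      refine Nat.add_lt_add_left (h5.trans_lt ?_) _
      simp only [phaseTerm, List.length_cons]
      omega
  | @sendBack S T R t a' σ t' s l ε hres hl hT hε =>
    change RouteInv D x S T R t a' σ at h
    refine ⟨h.sendBack hr hres hl hT hε, ?_⟩
    have hε0 := sendBack_amount_pos hres hT hε
    have hy : ∀ e, 0 < (sendBack σ t' s l ε).y e → 0 < σ.y e := by
      intro e he
      simp only [sendBack] at he
      split_ifs at he with h1
      · exact (hT e h1).2
      · exact he
    have hh : ∀ t'', height r (sendBack σ t' s l ε) t'' ≤ height r σ t'' := by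
      intro t''
      have h1 : (sendBack σ t' s l ε).dem t'' ≤ σ.dem t'' := by
        simp only [sendBack, Function.update_apply]
        split_ifs with h2
        · rw [h2]; linarith
        · exact le_rfl
      by_cases h3 : 0 < (sendBack σ t' s l ε).dem t''
      · unfold height
        rw [if_pos h3, if_pos (h3.trans_le h1)]
        exact le_rfl
      · unfold height
        rw [if_neg h3]
        exact Nat.zero_le _
    have h1 := (phaseTerm_route_le (D := D) S T R t a' (sendBack σ t' s l ε)).trans
      (show 1 ≤ Fintype.card V + 5 by omega)
    rcases hε.1 with h2 | ⟨e, he, h2⟩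
    -- Exhausting another token lowers its height. The split token stays active with the part
    -- reserved for `a'`, so its event is paid by the phase term, which falls from 1 to 0.
    · by_cases h3 : t' = t
      · subst h3
        refine add_lt_add_of_le_of_lt (Nat.mul_le_mul_left _ (remaining_le hh hy)) ?_
        have h4 := h.residual_sendBack (t' := t') (ε := ε) hT t'
        rw [if_pos rfl, ← Set.mem_singleton_iff.1 h2, sub_self] at h4
        simp only [phaseTerm, h4, hres, lt_irrefl, if_true, if_false]
        exact Nat.zero_lt_one
      · refine potential_lt_of_remaining_lt (remaining_lt_of_height hh hy (t := t') ?_) h1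
        have h4 : residual σ t a' t' = σ.dem t' := by simp only [residual, h3, if_false]
        have h5 : (sendBack σ t' s l ε).dem t' = 0 := by
          simp only [sendBack, Function.update_self]
          rw [Set.mem_singleton_iff.1 h2, h4, sub_self]
        unfold height
        rw [h5, if_neg (lt_irrefl _), if_pos (h4 ▸ hres)]
        omega
    · refine potential_lt_of_remaining_lt (remaining_lt_of_arc hh hy (hT e he).2 ?_) h1
      simp only [sendBack]
      rw [if_pos he, h2, sub_self]
  | @finishRoute S T R t a' σ hdone =>
    change RouteInv D x S T R t a' σ at h
    have hm := h.canMove hdone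
    rw [h.removeArcs_eq hr hN hdone]
    exact ⟨(h.moveInv hr hN hdone).move hm, potential_lt_of_remaining_lt
      (remaining_moveAlong_lt h.core hr hm.1 hm.2.1 hm.dem_le) (phaseTerm_move_le _ _)⟩

theorem Run.inv (hr : Ranked D x r) (hN : ∀ v, r v ≤ Fintype.card V) {κ κ' : Config V A b} {n : ℕ}
    (h : ConfigInv D x κ) (hrun : Run D b κ n κ') :
    ConfigInv D x κ' ∧ n + actionCost V A * potential D r κ' ≤ actionCost V A * potential D r κ := by
  induction hrun with
  | refl => exact ⟨h, by simp⟩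
  | tail _ hs ih =>
    obtain ⟨h1, h2⟩ := ih.1.step hr hN hs
    refine ⟨h1, le_trans ?_ ih.2⟩
    have := Nat.mul_le_mul_left (actionCost V A) (Nat.succ_le_of_lt h2)
    rw [Nat.mul_succ] at this
    omega

/-- With `N = n + m + 1`, the remaining events number at most `n * (n + 1) + (m + n)`, hence at most
`2 * N ^ 2`. The weight is at most `7 * N` and the phase term at most `5 * N`, which gives `14 + 5 =
19`. -/
theorem potential_initial_le (hN : ∀ v, r v ≤ Fintype.card V) :
    potential D r (initial b x) ≤ 19 * (Fintype.card V + Fintype.card A + 1) ^ 3 := by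
  have h1 : ∑ t, height r (initial b x).state t ≤
      Fintype.card V * (Fintype.card V + 1) := by
    have := Finset.sum_le_card_nsmul Finset.univ (height r (initial b x).state)
      (Fintype.card V + 1) fun t _ => by
        unfold height
        split_ifs
        · exact Nat.succ_le_succ (hN _)
        · exact Nat.zero_le _
    simpa using this
  have h2 : (Finset.univ.filter fun e => 0 < (initial b x).state.y e).card ≤
      Fintype.card A + Fintype.card V := by
    refine (Finset.card_le_univ _).trans ?_
    rw [Fintype.card_sum]
    exact Nat.add_le_add_left (Fintype.card_subtype_le _) _
  have h3 : phaseTerm D (initial b x) ≤ Fintype.card V + 5 := phaseTerm_move_le _ _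
  have h4 : remaining r (initial b x).state ≤
      2 * (Fintype.card V + Fintype.card A + 1) ^ 2 := by
    unfold remaining
    nlinarith
  unfold potential
  generalize Fintype.card V = n at *
  generalize Fintype.card A = m at *
  have h5 : (n + 7) * remaining r (initial b x).state ≤
      (7 * (n + m + 1)) * (2 * (n + m + 1) ^ 2) := Nat.mul_le_mul (by omega) h4
  have h6 : n + m + 1 ≤ (n + m + 1) ^ 3 := Nat.le_self_pow (by norm_num) _
  calc _ ≤ (7 * (n + m + 1)) * (2 * (n + m + 1) ^ 2) + (n + 5) := Nat.add_le_add h5 h3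
    _ ≤ 14 * (n + m + 1) ^ 3 + 5 * (n + m + 1) ^ 3 := by
      refine Nat.add_le_add (le_of_eq (by ring)) (by omega)
    _ = _ := by ring

theorem ConfigInv.exists_step (hr : Ranked D x r) {κ : Config V A b} (h : ConfigInv D x κ)
    (hfin : ¬ Finished κ) : ∃ κ', Step D b κ κ' := by
  obtain ⟨phase, σ⟩ := κ
  cases phase with
  | move S =>
    change MoveInv D x S σ at h
    by_cases hm : ∃ t e, CanMove D b S σ t e
    · obtain ⟨t, e, hm⟩ := hm
      exact ⟨_, .move hm⟩
    · have hstuck : ∀ t e, ¬ CanMove D b S σ t e := fun t e h' => hm ⟨t, e, h'⟩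
      simp only [Finished, not_forall] at hfin
      obtain ⟨t, ht⟩ := hfin
      have htpos : 0 < σ.dem t := lt_of_le_of_ne (h.core.dem_nonneg t) (Ne.symm ht)
      -- By conservation an active token is fed by an arc entering its vertex; the tail of that arc,
      -- possibly the super-source, can start the walk.
      have h1 := h.core.cons (σ.pos t)
      have h2 := le_demandAt (pos := σ.pos) h.core.dem_nonneg t
      have h3 := outflow_nonneg (D := D) h.core.nonneg (σ.pos t)
      rw [net_eq] at h1
      obtain ⟨e, -, he⟩ := exists_of_inflow_pos (D := D) (y := σ.y) (v := σ.pos t) (by linarith)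
      exact ⟨_, .iterate ⟨t, htpos⟩ hstuck (u := stail D b e) ⟨e, he, rfl⟩⟩
  | search u W =>
    obtain ⟨h1, h2, h3, h4⟩ := h
    exact h1.exists_step hr h2 h3 h4
  | route S T R t a' =>
    change RouteInv D x S T R t a' σ at h
    exact h.exists_step hr

end Execution

/-! ### The output of the algorithm -/

section Output

variable {V : Type u} {A : Type v} {D : Net V A} {b : V → ℝ} {x : A → ℝ}

theorem divergence_totalFlow [Fintype A] {P : List (PathFlow V A)}
    (hP : ∀ p ∈ P, IsPath D p.source p.arcs p.sink) (v : V) :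
    ∑ a, totalFlow P a * ((if D.tail a = v then 1 else 0) - (if D.head a = v then 1 else 0)) =
      (P.map fun p => if p.source = v then p.amount else 0).sum -
        (P.map fun p => if p.sink = v then p.amount else 0).sum := by
  induction P with
  | nil => simp [totalFlow]
  | cons p P ih =>
    obtain ⟨hp, hP⟩ := List.forall_mem_cons.1 hP
    have ih := ih hP
    unfold totalFlow at ih ⊢
    simp only [List.map_cons, List.sum_cons, add_mul, Finset.sum_add_distrib]
    rw [ih]
    have hn : p.arcs.Nodup := (List.nodup_cons.1 hp.2).2.of_map
    have h1 := sum_pulse_mul p.arcs id (fun _ => p.amount) fun a =>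
      ((if D.tail a = v then (1 : ℝ) else 0) - (if D.head a = v then 1 else 0))
    simp only [id, sum_pulse_of_nodup hn] at h1
    rw [h1]
    have h2 := hp.1.sum_sub fun u => if u = v then -p.amount else 0
    have h3 : (p.arcs.map fun a => p.amount *
        ((if D.tail a = v then (1 : ℝ) else 0) - (if D.head a = v then 1 else 0))).sum =
        (if p.source = v then p.amount else 0) - (if p.sink = v then p.amount else 0) := by
      refine Eq.trans ?_ (h2.trans ?_)
      · refine congrArg _ (List.map_congr_left fun a _ => ?_)
        by_cases h4 : D.tail a = v <;> by_cases h5 : D.head a = v <;> simp [h4, h5]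
      · by_cases h4 : p.source = v <;> by_cases h5 : p.sink = v <;> simp [h4, h5]
    rw [h3]
    ring

variable [Fintype V] {σ : State V A b}

theorem LoadOK.load_le {S : Set (SArc A b)} {M : ℝ} {a : A} (h : LoadOK x S σ M a)
    (hy : 0 ≤ σ.y (.inl a)) (hM : 0 ≤ M) : load σ a ≤ x a + M := by
  rcases h with h | h | h <;> linarith

variable [Fintype A]

/-- Summed over all vertices, original arcs cancel and dummy arcs count once. Their nonnegative
flows thus add up to the total remaining demand, which is zero. -/
theorem Core.y_inr_eq_zero (h : Core D x σ) (hfin : ∀ t, σ.dem t = 0) (s : {s : V // 0 < b s}) :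
    σ.y (.inr s) = 0 := by
  have h1 : ∑ v, net D b σ.y v = 0 :=
    Finset.sum_eq_zero fun v _ => (h.cons v).trans (Finset.sum_eq_zero fun t _ => by simp [hfin])
  have h2 : ∑ v, net D b σ.y v = ∑ s, σ.y (.inr s) := by
    unfold net
    rw [Finset.sum_comm]
    simp only [← Finset.mul_sum, Fintype.sum_sum_type, incidence_inl, incidence_inr]
    simp
  rw [h2] at h1
  exact (Finset.sum_eq_zero_iff_of_nonneg fun s _ => h.nonneg _).1 h1 s (Finset.mem_univ s)

theorem ConfigInv.core {κ : Config V A b} (h : ConfigInv D x κ) : Core D x κ.state := by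
  obtain ⟨phase, σ⟩ := κ
  cases phase with
  | move S => exact MoveInv.core h
  | search u W => exact SearchInv.core h.1
  | route S T R t a' => exact RouteInv.core h

theorem ConfigInv.nodup {κ : Config V A b} (h : ConfigInv D x κ) :
    (κ.state.routed.map fun p => (p.source, p.sink)).Nodup := by
  obtain ⟨phase, σ⟩ := κ
  cases phase with
  | move S => exact PairsOK.nodup (MoveInv.pairs h)
  | search u W => exact PairsOK.nodup (SearchInv.pairs h.1)
  | route S T R t a' => exact RouteInv.nodup h

theorem ConfigInv.load_le {κ : Config V A b} (h : ConfigInv D x κ) {M : ℝ} (hM : DemandBound b M)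
    (hM0 : 0 ≤ M) (a : A) : load κ.state a ≤ x a + M := by
  have hy := h.core.nonneg (.inl a)
  obtain ⟨phase, σ⟩ := κ
  cases phase with
  | move S => exact (MoveInv.load h M hM a).load_le hy hM0
  | search u W => exact (SearchInv.load h.1 M hM a).load_le hy hM0
  | route S T R t a' =>
    change RouteInv D x S T R t a' σ at h
    by_cases ha : .inl a ∈ T
    · have := h.load_mem M hM a ha
      change 0 ≤ σ.y (.inl a) at hy
      linarith
    · exact (h.load_notMem M hM a ha).load_le hy hM0

/-- The bookkeeping of `src` and `snk` becomes exact once all demands and dummy flows are zero, and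
the divergence of a sum of paths sees only their ends. Routed walks are paths because their arcs lie
in the support of `x`. -/
theorem ConfigInv.isUnsplittable {r : V → ℕ} (hr : Ranked D x r) {κ : Config V A b}
    (h : ConfigInv D x κ) (hfin : Finished κ) : IsUnsplittable D b κ.state.routed := by
  have hc := h.core
  have hpath : ∀ p ∈ κ.state.routed, IsPath D p.source p.arcs p.sink :=
    fun p hp => (hc.walk p hp).isPath hr (hc.arcs_supp p hp)
  refine ⟨hc.source_pos, hc.sink_neg, hc.amount_pos, hpath, h.nodup,
    isTransshipment_iff.2 ⟨fun a => List.sum_nonneg ?_, fun v => ?_⟩⟩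
  · simp only [List.mem_map]
    rintro _ ⟨p, hp, rfl⟩
    split_ifs
    exacts [(hc.amount_pos p hp).le, le_rfl]
  · rw [divergence_totalFlow hpath]
    have h1 := hc.snk v
    rw [hfin v, add_zero] at h1
    rw [h1]
    rcases lt_or_ge 0 (b v) with hv | hv
    · have h2 := hc.src ⟨v, hv⟩
      rw [hc.y_inr_eq_zero hfin, add_zero] at h2
      rw [h2, max_eq_right (by linarith), sub_zero]
    · rw [max_eq_left (by linarith), List.sum_eq_zero]
      · ring
      · simp only [List.mem_map]
        rintro _ ⟨p, hp, rfl⟩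
        rw [if_neg]
        rintro rfl
        exact absurd (hc.source_pos p hp) (not_lt.2 hv)

theorem ConfigInv.totalFlow_le {c : A → ℝ} (hc : ∀ a, 0 ≤ c a) (hb : BalanceCondition b c)
    {κ : Config V A b} (h : ConfigInv D x κ) (hfin : Finished κ) (a : A) :
    totalFlow κ.state.routed a ≤ x a + c a := by
  -- The load invariant is stated for every demand bound, so the capacity of this very arc can be
  -- used.
  have hM : DemandBound b (c a) := by
    intro t
    refine max_le ?_ (hc a)
    rcases lt_or_ge (b t) 0 with ht | ht
    · exact (neg_le_abs (b t)).trans (hb t ht a)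
    · linarith [hc a]
  have h1 := h.load_le hM (hc a) a
  have h2 : trailLoad κ.state.trail κ.state.dem a = 0 :=
    Finset.sum_eq_zero fun t _ => by simp [hfin t]
  rwa [load, h2, add_zero] at h1

end Output

end UnsplitTrans

/-! ### Running time and approximation guarantee -/

theorem mainTheorem5 :
    ∃ C k : ℕ, ∀ (V : Type u) (A : Type v) [Fintype V] [Fintype A]
      (D : UnsplitTrans.Net V A) (b : V → ℝ) (c : A → ℝ),
      (∀ a, 0 ≤ c a) → UnsplitTrans.BalanceCondition b c →
      -- an optimal fractional solution to start from exists
      ((∃ x, UnsplitTrans.IsTransshipment D b x) →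
        ∃ x, UnsplitTrans.IsOptimalFractional D b c x) ∧
      -- every execution that starts from an optimal fractional solution
      ∀ x, UnsplitTrans.IsOptimalFractional D b c x →
        ∀ (T : ℕ) (κ : UnsplitTrans.Config V A b),
          UnsplitTrans.Run D b (UnsplitTrans.initial b x) T κ →
          -- takes polynomial time,
          T ≤ C * (Fintype.card V + Fintype.card A + 1) ^ k ∧
          -- does not stop before all sinks have reached the super-source,
          (¬ UnsplitTrans.Finished κ → ∃ κ', UnsplitTrans.Step D b κ κ') ∧
          -- and then returns an unsplittable transshipment within factor 2 of the optimum
          (UnsplitTrans.Finished κ →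
            UnsplitTrans.IsUnsplittable D b κ.state.routed ∧
            ∀ Q, UnsplitTrans.IsUnsplittable D b Q →
              UnsplitTrans.congestionFactor c (UnsplitTrans.totalFlow κ.state.routed) ≤
                2 * UnsplitTrans.congestionFactor c (UnsplitTrans.totalFlow Q)) := by
  -- The potential is at most `19 * N ^ 3` initially, and each action costs `N ^ 2`, where `N` is
  -- the number of vertices and arcs plus one.
  refine ⟨19, 5, fun V A _ _ D b c hc hb =>
    ⟨fun ⟨_, hx⟩ => UnsplitTrans.exists_isOptimalFractional hb hx, fun x hx T κ hrun => ?_⟩⟩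
  obtain ⟨r, hr, hN⟩ := hx.acyclic.exists_rank
  have h0 : UnsplitTrans.ConfigInv D x (UnsplitTrans.initial b x) :=
    UnsplitTrans.moveInv_initial hx.isTransshipment
  obtain ⟨hinv, hT⟩ := hrun.inv hr hN h0
  refine ⟨?_, hinv.exists_step hr, fun hfin => ⟨hinv.isUnsplittable hr hfin, fun Q hQ => ?_⟩⟩
  · have h1 := UnsplitTrans.potential_initial_le (D := D) (b := b) (x := x) hN
    calc T ≤ UnsplitTrans.actionCost V A *
          UnsplitTrans.potential D r (UnsplitTrans.initial b x) := by omega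
      _ ≤ (Fintype.card V + Fintype.card A + 1) ^ 2 *
          (19 * (Fintype.card V + Fintype.card A + 1) ^ 3) := Nat.mul_le_mul_left _ h1
      _ = _ := by ring
  · refine (UnsplitTrans.congestionFactor_le_two_mul hc
      fun a => hinv.totalFlow_le hc hb hfin a).trans ?_
    exact mul_le_mul_of_nonneg_left (hx.minimal _ hQ.isTransshipment) zero_le_two
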